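/- **Notation.** Let $\mathbb R_+=(0,\infty)$ and let $k\in\{0,1,2,\dots\}$. Let $G=\{(u,v):u\in\mathbb R,\ v>0\}$ with the measure $d\nu=v^{-2}\,du\,dv$. Put $\ell_k(y)=e^{-y/2}L_k(y)$, where $L_k(y)=\sum_{i=0}^k(-1)^i\binom ki\frac{y^i}{i!}$ is the Laguerre polynomial. Let $\hat f(\xi)=\int_{\mathbb R} f(x)e^{-2\pi i x\xi}\,dx$ denote the unitary Fourier transform on $L_2(\mathbb R)$, and let $H_2^+(\mathbb R)$ be the space of all $f\in L_2(\mathbb R)$ with $\operatorname{supp}\hat f\subseteq[0,\infty)$. Let $\psi^{(k)}\in L_2(\mathbb R)$ be the wavelet with $\hat\psi^{(k)}(\xi)=\chi_{(0,\infty)}(\xi)\sqrt{2\xi}\,\ell_k(2\xi)$, and put $\psi^{(k)}_v(u)=v^{-1/2}\psi^{(k)}(u/v)$. The wavelet subspace is $$A^{(k)}=\{(u,v)\mapsto (f*\psi_v^{(k)})(u):\ f\in H_2^+(\mathbb R)\}\subset L_2(G,d\nu).$$ For a measurable function $a$ on $G$, let $T^{(k)}_a=P^{(k)}M_a$ be the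 Calderón–Toeplitz operator on $A^{(k)}$, with domain $\{F\in A^{(k)}: aF\in L_2(G,d\nu)\}$ (this is all of $A^{(k)}$ if $a$ is bounded), where $M_a$ is multiplication by $a$ and $P^{(k)}$ is the orthogonal projection of $L_2(G,d\nu)$ onto $A^{(k)}$. Let $R_k=Q_k^*U_2U_1$ on $A^{(k)}$, where $U_1$ is the Fourier transform in the variable $u$, $(U_2F)(x,y)=\frac{\sqrt{2|x|}}{y}F\big(x,\frac{y}{2|x|}\big)$ and $(Q_k^*F)(x)=\int_{\mathbb R_+}F(x,t)\ell_k(t)\,dt$ for $x>0$. **Theorem.** The subspace $A^{(k)}$ is closed in $L_2(G,d\nu)$, and $R_k$ is a unitary operator of $A^{(k)}$ onto $L_2(\mathbb R_+)$, with inverse $$(R_k^*f)(u,v)=\sqrt2\,v\int_{\mathbb R_+}f(\xi)\,\ell_k(2\xi v)\,e^{2\pi i\xi u}\sqrt\xi\,d\xi .$$ Let $a=a(v)$ be a measurable complex function on $\mathbb R_+$, regarded as a symbol on $G$ that does not depend on $u$, and put $$\gamma_{a,k}(\xi)=\int_{\mathbb R_+}a\Big(\frac{v}{2\xi}\Big)\,\ell_k(v)^2\,dv,\qquad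 \xi\in\mathbb R_+ .$$ 1. If $a$ is (essentially) bounded, then $T_a^{(k)}$ is defined on all of $A^{(k)}$, the integral $\gamma_{a,k}(\xi)$ converges absolutely for every $\xi>0$, $|\gamma_{a,k}|\le\|a\|_\infty$, and $T_a^{(k)}$ is unitarily equivalent via $R_k$ to the operator of multiplication by $\gamma_{a,k}$ on $L_2(\mathbb R_+)$: $$R_k\,T_a^{(k)}\,R_k^{*}=\gamma_{a,k}I .$$ 2. For an arbitrary measurable $a$, a function $F\in A^{(k)}$ belongs to the domain of $T_a^{(k)}$ if and only if $\int_{\mathbb R_+}\Big(\int_{\mathbb R_+}|a(\tfrac{v}{2\xi})|^2\ell_k(v)^2\,dv\Big)|(R_kF)(\xi)|^2\,d\xi<\infty$. For every such $F$, the integral $\gamma_{a,k}(\xi)$ converges absolutely for almost every $\xi$ with $(R_kF)(\xi)\ne0$, the function $\gamma_{a,k}\,R_kF$ lies in $L_2(\mathbb R_+)$, and $R_kT_a^{(k)}F=\gamma_{a,k}\,R_kF$. -/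

import Mathlib

open MeasureTheory Set FourierTransform
open scoped ENNReal

namespace CalderonToeplitz

noncomputable section

/-! ### Laguerre functions -/

/-- The Laguerre polynomial of degree `k` (and type `0`),
`L_k(y) = ∑_{i ≤ k} (-1)^i (k choose i) y^i / i!`. -/
def laguerrePoly (k : ℕ) : Polynomial ℝ :=
  ∑ i ∈ Finset.range (k + 1),
    Polynomial.C ((-1) ^ i * (k.choose i : ℝ) / (i.factorial : ℝ)) * Polynomial.X ^ i

/-- The Laguerre function `ℓ_k(y) = e^{-y/2} L_k(y)`. -/
def laguerreFun (k : ℕ) (y : ℝ) : ℝ :=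
  Real.exp (-y / 2) * (laguerrePoly k).eval y

theorem continuous_laguerreFun (k : ℕ) : Continuous (laguerreFun k) := by
  unfold laguerreFun
  fun_prop

theorem integrableOn_poly_mul_exp (p : Polynomial ℝ) :
    IntegrableOn (fun x : ℝ => p.eval x * Real.exp (-x)) (Ioi 0) := by
  induction p using Polynomial.induction_on' with
  | add p q hp hq =>
    simp only [Polynomial.eval_add, add_mul]
    exact hp.add hq
  | monomial n c =>
    have h := (Real.GammaIntegral_convergent (s := (n : ℝ) + 1) (by positivity)).const_mul c
    refine h.congr ?_
    filter_upwards with x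
    simp only [Polynomial.eval_monomial, add_sub_cancel_right, Real.rpow_natCast]
    ring

/-! ### The wavelets, the Hardy space and the wavelet subspaces -/

/-- The function `ξ ↦ χ_+(ξ) √(2ξ) ℓ_k(2ξ)`, the Fourier transform of the wavelet `ψ^{(k)}`. -/
def waveletHat (k : ℕ) : ℝ → ℂ :=
  (Ioi (0 : ℝ)).indicator fun ξ => ((√(2 * ξ) * laguerreFun k (2 * ξ) : ℝ) : ℂ)

theorem memLp_waveletHat (k : ℕ) : MemLp (waveletHat k) 2 (volume : Measure ℝ) := by
  unfold waveletHat
  rw [memLp_indicator_iff_restrict measurableSet_Ioi]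
  have hc : Continuous fun ξ : ℝ => ((√(2 * ξ) * laguerreFun k (2 * ξ) : ℝ) : ℂ) := by
    have := continuous_laguerreFun k
    fun_prop
  rw [memLp_two_iff_integrable_sq_norm hc.aestronglyMeasurable]
  have h := integrableOn_poly_mul_exp (Polynomial.X * laguerrePoly k ^ 2)
  have h2 := (integrableOn_Ioi_comp_mul_left_iff
    (fun x : ℝ => (Polynomial.X * laguerrePoly k ^ 2).eval x * Real.exp (-x)) 0
    (a := 2) (by norm_num)).2 (by simpa using h)
  refine IntegrableOn.congr_fun h2 ?_ measurableSet_Ioi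
  intro x hx
  have hx' : (0 : ℝ) ≤ 2 * x := by have : (0 : ℝ) < x := hx; linarith
  have he : Real.exp (-(2 * x)) = Real.exp (-(2 * x) / 2) ^ 2 := by
    rw [← Real.exp_nat_mul]; congr 1; push_cast; ring
  simp only [Complex.norm_real, Real.norm_eq_abs, sq_abs, mul_pow, Real.sq_sqrt hx', laguerreFun,
    Polynomial.eval_mul, Polynomial.eval_X, Polynomial.eval_pow, he]
  ring

/-- The wavelet `ψ^{(k)} ∈ L₂(ℝ)`, given by its (unitary) Fourier transform. -/
def wavelet (k : ℕ) : Lp ℂ 2 (volume : Measure ℝ) :=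
  (Lp.fourierTransformₗᵢ ℝ ℂ).symm ((memLp_waveletHat k).toLp (waveletHat k))

/-- The dilation `ψ_v(u) = v^{-1/2} ψ(u/v)`. -/
def dilate (v : ℝ) (ψ : ℝ → ℂ) (u : ℝ) : ℂ :=
  (((√v)⁻¹ : ℝ) : ℂ) * ψ (u / v)

theorem memLp_dilate {ψ : ℝ → ℂ} (hψ : MemLp ψ 2 volume) {v : ℝ} (hv : 0 < v) :
    MemLp (dilate v ψ) 2 volume := by
  refine MemLp.const_mul ?_ _
  have h1 : MemLp ψ 2 (Measure.map (fun u : ℝ => u * v⁻¹) volume) := by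
    rw [Real.map_volume_mul_right (inv_ne_zero hv.ne')]
    exact hψ.smul_measure ENNReal.ofReal_ne_top
  simpa [Function.comp_def, div_eq_mul_inv] using h1.comp_of_map (by fun_prop)

/-- The Hardy space `H₂⁺(ℝ)` of all `h ∈ L₂(ℝ)` whose Fourier transform is supported in
`[0, ∞)`. -/
def hardyPlus : Submodule ℂ (Lp ℂ 2 (volume : Measure ℝ)) where
  carrier := {h | ∀ᵐ ξ, ξ < 0 → Lp.fourierTransformₗᵢ ℝ ℂ h ξ = 0}
  zero_mem' := by
    simp only [mem_ofPred_eq, map_zero]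
    filter_upwards [Lp.coeFn_zero ℂ 2 (volume : Measure ℝ)] with ξ _ _
    simp
  add_mem' := by
    intro f g hf hg
    simp only [mem_ofPred_eq, map_add] at *
    filter_upwards [hf, hg, Lp.coeFn_add (Lp.fourierTransformₗᵢ ℝ ℂ f)
      (Lp.fourierTransformₗᵢ ℝ ℂ g)] with ξ h1 h2 h3 h
    rw [h3, Pi.add_apply, h1 h, h2 h, add_zero]
  smul_mem' := by
    intro c f hf
    simp only [mem_ofPred_eq, map_smul] at *
    filter_upwards [hf, Lp.coeFn_smul c (Lp.fourierTransformₗᵢ ℝ ℂ f)] with ξ h1 h3 h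
    rw [h3, Pi.smul_apply, h1 h, smul_zero]

/-- The continuous wavelet transform `(W_k f)(u, v) = (f * ψ^{(k)}_v)(u)`. -/
def waveletTransform (k : ℕ) (f : ℝ → ℂ) (ζ : ℝ × ℝ) : ℂ :=
  convolution f (dilate ζ.2 (wavelet k)) (ContinuousLinearMap.mul ℂ ℂ) volume ζ.1

/-- The measure `v⁻² dv` on `ℝ_+`. -/
def nuPlus : Measure ℝ :=
  (volume.restrict (Ioi 0)).withDensity fun v => ENNReal.ofReal ((v ^ 2)⁻¹)

instance : SFinite nuPlus := by
  unfold nuPlus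
  infer_instance

/-- The left-invariant Haar measure `dν(u, v) = v⁻² du dv` of the group `G = ℝ × ℝ_+`, as a measure
on `ℝ × ℝ` carried by `{v > 0}`. -/
def nu : Measure (ℝ × ℝ) := (volume : Measure ℝ).prod nuPlus

theorem ae_nu_pos : ∀ᵐ ζ ∂nu, 0 < ζ.2 := by
  have h : ∀ᵐ v ∂nuPlus, 0 < v :=
    (withDensity_absolutelyContinuous _ _).ae_le (ae_restrict_mem measurableSet_Ioi)
  exact Measure.quasiMeasurePreserving_snd.ae h

theorem convolutionExistsAt_dilate {f ψ : ℝ → ℂ} (hf : MemLp f 2 volume) (hψ : MemLp ψ 2 volume)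
    {v : ℝ} (hv : 0 < v) (u : ℝ) :
    ConvolutionExistsAt f (dilate v ψ) u (ContinuousLinearMap.mul ℂ ℂ) volume := by
  have h : MemLp (fun t => dilate v ψ (u - t)) 2 volume :=
    (memLp_dilate hψ hv).comp_measurePreserving (Measure.measurePreserving_sub_left volume u)
  simpa [ConvolutionExistsAt] using! hf.integrable_mul h

/-- The space `L₂(G, dν)`. -/
abbrev L2G : Type := Lp ℂ 2 nu

/-- The space `L₂(ℝ_+)`. -/
abbrev L2Plus : Type := Lp ℂ 2 ((volume : Measure ℝ).restrict (Ioi 0))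

/-- The wavelet subspace `A^{(k)} = {W_k f : f ∈ H₂⁺(ℝ)}` of `L₂(G, dν)`. -/
def waveletSubspace (k : ℕ) : Submodule ℂ L2G where
  carrier := {F | ∃ f ∈ hardyPlus, F =ᵐ[nu] waveletTransform k f}
  zero_mem' := by
    refine ⟨0, hardyPlus.zero_mem, ?_⟩
    filter_upwards [Lp.coeFn_zero ℂ 2 nu] with ζ h
    rw [h, waveletTransform, convolution]
    refine (integral_eq_zero_of_ae ?_).symm
    filter_upwards [Lp.coeFn_zero ℂ 2 (volume : Measure ℝ)] with t _
    simp
  add_mem' := by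
    rintro F G ⟨f, hf, hF⟩ ⟨g, hg, hG⟩
    refine ⟨f + g, hardyPlus.add_mem hf hg, ?_⟩
    filter_upwards [hF, hG, Lp.coeFn_add F G, ae_nu_pos] with ζ h1 h2 h3 hpos
    rw [h3, Pi.add_apply, h1, h2]
    have e1 := convolutionExistsAt_dilate (Lp.memLp f) (Lp.memLp (wavelet k)) hpos ζ.1
    have e2 := convolutionExistsAt_dilate (Lp.memLp g) (Lp.memLp (wavelet k)) hpos ζ.1
    simp only [waveletTransform]
    rw [← e1.add_distrib e2]
    simp only [convolution]
    refine integral_congr_ae ?_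
    filter_upwards [Lp.coeFn_add f g] with t ht
    rw [ht]
  smul_mem' := by
    rintro c F ⟨f, hf, hF⟩
    refine ⟨c • f, hardyPlus.smul_mem c hf, ?_⟩
    filter_upwards [hF, Lp.coeFn_smul c F] with ζ h1 h3
    rw [h3, Pi.smul_apply, h1]
    simp only [waveletTransform, convolution]
    rw [← integral_smul]
    refine integral_congr_ae ?_
    filter_upwards [Lp.coeFn_smul c f] with t ht
    simp [ht, mul_assoc]

/-! ### Multiplication operators and Calderón–Toeplitz operators -/

/-- The operator of pointwise multiplication by `g` on `L₂(μ)`, with its maximal domain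
`{f ∈ L₂(μ) : g f ∈ L₂(μ)}`. -/
def mulOp {α : Type*} [MeasurableSpace α] (μ : Measure α) (g : α → ℂ) :
    Lp ℂ 2 μ →ₗ.[ℂ] Lp ℂ 2 μ where
  domain :=
    { carrier := {f | MemLp (fun x => g x * f x) 2 μ}
      zero_mem' := by
        refine (memLp_congr_ae ?_).2 (MemLp.zero (ε := ℂ) (p := 2) (μ := μ))
        filter_upwards [Lp.coeFn_zero ℂ 2 μ] with x hx
        rw [hx]; simp
      add_mem' := by
        intro f h hf hh
        refine (memLp_congr_ae ?_).2 (MemLp.add hf hh)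
        filter_upwards [Lp.coeFn_add f h] with x hx
        rw [hx]; simp [mul_add]
      smul_mem' := by
        intro c f hf
        refine (memLp_congr_ae ?_).2 (MemLp.const_smul hf c)
        filter_upwards [Lp.coeFn_smul c f] with x hx
        rw [hx]; simp [mul_left_comm] }
  toFun :=
    { toFun := fun f => MemLp.toLp (fun x => g x * (f : Lp ℂ 2 μ) x) f.2
      map_add' := by
        intro f h
        rw [← MemLp.toLp_add, MemLp.toLp_eq_toLp_iff]
        filter_upwards [Lp.coeFn_add (f : Lp ℂ 2 μ) (h : Lp ℂ 2 μ)] with x hx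
        change g x * ((f : Lp ℂ 2 μ) + (h : Lp ℂ 2 μ) : Lp ℂ 2 μ) x = _
        rw [hx]; simp [mul_add]
      map_smul' := by
        intro c f
        rw [RingHom.id_apply, ← MemLp.toLp_const_smul, MemLp.toLp_eq_toLp_iff]
        filter_upwards [Lp.coeFn_smul c (f : Lp ℂ 2 μ)] with x hx
        change g x * (c • (f : Lp ℂ 2 μ) : Lp ℂ 2 μ) x = _
        rw [hx]; simp [mul_left_comm] }

/-- The Calderón–Toeplitz operator `T_a^{(k)} = P^{(k)} M_a` on `A^{(k)}` with symbol `a` on `G`,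
where `P^{(k)}` is the orthogonal projection of `L₂(G, dν)` onto `A^{(k)}`. Its domain consists of
all `F ∈ A^{(k)}` with `a F ∈ L₂(G, dν)`; it is all of `A^{(k)}` when `a` is bounded. -/
def toeplitz (k : ℕ) (a : ℝ × ℝ → ℂ) [(waveletSubspace k).HasOrthogonalProjection] :
    waveletSubspace k →ₗ.[ℂ] waveletSubspace k where
  domain := (mulOp nu a).domain.comap (waveletSubspace k).subtype
  toFun :=
    { toFun := fun F => (waveletSubspace k).orthogonalProjectionOnto
        (mulOp nu a ⟨((F : waveletSubspace k) : L2G), F.2⟩)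
      map_add' := by
        intro F G
        rw [← map_add, ← LinearPMap.map_add]
        rfl
      map_smul' := by
        intro c F
        rw [RingHom.id_apply, ← map_smul, ← LinearPMap.map_smul]
        rfl }

/-- Two (possibly unbounded) operators `S`, `T` are unitarily equivalent via the unitary operator
`R`, i.e. `T = R S R⁻¹` including domains: `R × R` maps the graph of `S` onto the graph of `T`. -/
def UnitarilyEquivalentVia {H K : Type*} [NormedAddCommGroup H] [InnerProductSpace ℂ H]
    [NormedAddCommGroup K] [InnerProductSpace ℂ K] (R : H ≃ₗᵢ[ℂ] K)
    (S : H →ₗ.[ℂ] H) (T : K →ₗ.[ℂ] K) : Prop :=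
  ∀ x y : H, (x, y) ∈ S.graph ↔ (R x, R y) ∈ T.graph

/-! ### The Bargmann-type transform -/

/-- `H = U₁ F`, where `U₁ = 𝓕 ⊗ I` is the Fourier transform in the horizontal variable on
`L₂(G, dν) = L₂(ℝ, du) ⊗ L₂(ℝ_+, v⁻² dv)`: for almost every `v > 0`, `H(·, v)` is the Fourier
transform of `F(·, v) ∈ L₂(ℝ)`. -/
def IsHorizontalFourier (F H : L2G) : Prop :=
  ∀ᵐ v ∂((volume : Measure ℝ).restrict (Ioi 0)),
    ∃ h : MemLp (fun u : ℝ => F (u, v)) 2 (volume : Measure ℝ),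
      Lp.fourierTransformₗᵢ ℝ ℂ (h.toLp _) =ᵐ[volume] fun ω => H (ω, v)

/-- The operator `U₂ : F(ω, v) ↦ (√(2|x|) / y) F(x, y / (2|x|))` from
`L₂(ℝ, dω) ⊗ L₂(ℝ_+, v⁻² dv)` to `L₂(ℝ, dx) ⊗ L₂(ℝ_+, dy)`. -/
def opU2 (F : ℝ × ℝ → ℂ) (z : ℝ × ℝ) : ℂ :=
  ((√(2 * |z.1|) / z.2 : ℝ) : ℂ) * F (z.1, z.2 / (2 * |z.1|))

/-- The operator `(Q_k^* F)(x) = ∫_{ℝ_+} F(x, t) ℓ_k(t) dt`, `x > 0`, from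
`L₂(ℝ) ⊗ L₂(ℝ_+)` to `L₂(ℝ_+)`. -/
def opQStar (k : ℕ) (F : ℝ × ℝ → ℂ) (x : ℝ) : ℂ :=
  ∫ t in Ioi (0 : ℝ), F (x, t) * ((laguerreFun k t : ℝ) : ℂ)

/-- The explicit form
`(R_k^* f)(u, v) = √2 v ∫_{ℝ_+} f(ξ) ℓ_k(2ξv) e^{2πiξu} √ξ dξ` of the inverse transform. -/
def bargmannInv (k : ℕ) (f : ℝ → ℂ) (ζ : ℝ × ℝ) : ℂ :=
  ((√2 * ζ.2 : ℝ) : ℂ) * ∫ ξ in Ioi (0 : ℝ),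
    f ξ * ((laguerreFun k (2 * ξ * ζ.2) : ℝ) : ℂ) *
      Complex.exp (2 * Real.pi * Complex.I * ξ * ζ.1) * ((√ξ : ℝ) : ℂ)

/-- `R` is the Bargmann-type transform `R_k = Q_k^* U₂ U₁` on `A^{(k)}`, with inverse the operator
`R_k^*` given by its integral formula. Either of the two conditions determines `R`. -/
def IsBargmann (k : ℕ) (R : waveletSubspace k ≃ₗᵢ[ℂ] L2Plus) : Prop :=
  (∀ F : waveletSubspace k, ∃ H : L2G, IsHorizontalFourier F H ∧
    R F =ᵐ[volume.restrict (Ioi 0)] opQStar k (opU2 H)) ∧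
  ∀ f : L2Plus, ((R.symm f : waveletSubspace k) : L2G) =ᵐ[nu] bargmannInv k f

/-- The function `γ_{a,k}(ξ) = ∫_{ℝ_+} a(v / (2ξ)) ℓ_k(v)² dv`. -/
def gammaFun (k : ℕ) (a : ℝ → ℂ) (ξ : ℝ) : ℂ :=
  ∫ v in Ioi (0 : ℝ), a (v / (2 * ξ)) * ((laguerreFun k v ^ 2 : ℝ) : ℂ)

end

end CalderonToeplitz

open CalderonToeplitz

namespace CalderonToeplitz

/-! ### Normalization of the Laguerre functions -/

/-! The horizontal Fourier transform sends `f * ψ_v` to `√v · ψ̂(vξ) · f̂(ξ)`. Hence, for ξ > 0, the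
fibre of the transformed space over ξ is the line spanned by one profile, `v ↦ √2 v √ξ ℓ_k(2ξv)`.
Under y = 2ξv its squared norm for `v⁻² dv` becomes `∫ ℓ_k² = 1`; this normalization comes from the
Laguerre moments. So `R_k^*`, which multiplies f(ξ) by the profile and inverts the Fourier transform
in u, is an isometry of `L₂(ℝ_+)`. Parseval identifies its range with `A^{(k)}`
(`waveletTransform_eq_bargmannInv`, `waveletSubspace_eq_range`), which gives closedness. `R_k` is
defined as the inverse of this isometry, and the formula `Q_k^* U₂ U₁` is then verified.

A symbol a(v) commutes with the Fourier transform in u, so it acts on each fibre separately.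
Compressing multiplication by a to a unit profile gives the scalar `∫ a(v) · 2ξ ℓ_k(2ξv)² dv =
γ(ξ)`. As an identity of forms this reads `⟨a R^*f, R^*g⟩ = ∫ γ f ḡ`
(`integral_symbol_bargmannInv_mul_conj`). The projection is invisible when tested against `A^{(k)}`,
so the form determines `R T_a R^*`.

For unbounded a, the weighted Plancherel identity `lintegral_bargmannInv` with weight |a|² describes
the domain exactly. Cauchy–Schwarz against the unit vector `ℓ_k` bounds |γ|² by the inner integral
of that criterion, so γ · RF is square integrable on the domain. -/

theorem integral_pow_mul_exp_neg (n : ℕ) :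
    ∫ x in Ioi (0 : ℝ), x ^ n * Real.exp (-x) = (n.factorial : ℝ) := by
  rw [← Real.Gamma_nat_eq_factorial, Real.Gamma_eq_integral (by positivity)]
  refine setIntegral_congr_fun measurableSet_Ioi fun x _ => ?_
  simp only [add_sub_cancel_right, Real.rpow_natCast]
  ring

/-- Since (i+j)! = i! · (i+1)⋯(i+j), the i! cancels the denominator in `L_k`. What remains is an
alternating binomial sum, that is, a k-th difference of a rising factorial of degree j. It vanishes
for j < k. -/
theorem integral_pow_mul_laguerrePoly (k j : ℕ) :
    ∫ x in Ioi (0 : ℝ), (Polynomial.X ^ j * laguerrePoly k).eval x * Real.exp (-x) =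
      (-1) ^ k * (fwdDiff 1)^[k] (ascPochhammer ℝ j).eval 1 := by
  have h1 : ∀ x : ℝ, (Polynomial.X ^ j * laguerrePoly k).eval x * Real.exp (-x) =
      ∑ i ∈ Finset.range (k + 1), ((-1) ^ i * (k.choose i : ℝ) / (i.factorial : ℝ)) *
        (x ^ (i + j) * Real.exp (-x)) := by
    intro x
    simp only [laguerrePoly, Polynomial.eval_mul, Polynomial.eval_pow, Polynomial.eval_X,
      Polynomial.eval_finsetSum, Polynomial.eval_C, Finset.mul_sum, Finset.sum_mul]
    refine Finset.sum_congr rfl fun i _ => ?_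
    ring
  simp_rw [h1]
  rw [integral_finsetSum]
  · simp_rw [integral_const_mul, integral_pow_mul_exp_neg]
    rw [fwdDiff_iter_eq_sum_shift, Finset.mul_sum]
    refine Finset.sum_congr rfl fun i hi => ?_
    have hik : i ≤ k := Nat.lt_succ_iff.mp (Finset.mem_range.mp hi)
    have h2 : (ascPochhammer ℝ j).eval (1 + i • (1 : ℝ)) = ((i + 1).ascFactorial j : ℝ) := by
      rw [← ascPochhammer_nat_eq_ascFactorial, ascPochhammer_eval_cast]
      congr 1
      push_cast
      simp [add_comm]
    have h3 : ((i + j).factorial : ℝ) = i.factorial * ((i + 1).ascFactorial j : ℝ) := by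
      rw [← Nat.factorial_mul_ascFactorial]; push_cast; rfl
    have h4 : (-1 : ℝ) ^ k * (-1) ^ (k - i) = (-1) ^ i := by
      obtain ⟨m, rfl⟩ := Nat.exists_eq_add_of_le hik
      rw [Nat.add_sub_cancel_left, pow_add, mul_assoc, ← pow_add, Even.neg_one_pow ⟨m, rfl⟩,
        mul_one]
    have h5 : (i.factorial : ℝ) ≠ 0 := by positivity
    rw [h2, h3, ← h4, zsmul_eq_mul]
    push_cast
    field_simp
  · intro i _
    have := integrableOn_poly_mul_exp (Polynomial.X ^ (i + j))
    simp only [Polynomial.eval_pow, Polynomial.eval_X] at this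
    exact this.const_mul _

theorem laguerrePoly_coeff (k j : ℕ) :
    (laguerrePoly k).coeff j =
      if j < k + 1 then (-1) ^ j * (k.choose j : ℝ) / (j.factorial : ℝ) else 0 := by
  simp [laguerrePoly, Polynomial.finsetSum_coeff]

theorem natDegree_laguerrePoly_lt (k : ℕ) : (laguerrePoly k).natDegree < k + 1 := by
  rw [Nat.lt_succ_iff, Polynomial.natDegree_le_iff_coeff_eq_zero]
  intro j hj
  rw [laguerrePoly_coeff, if_neg (by omega)]

/-- Expanding one factor in monomials, only the degree k term survives. The k-th difference of a
monic polynomial of degree k is k!, which cancels the leading coefficient (-1)^k / k! up to the sign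
already present. -/
theorem integral_laguerrePoly_sq (k : ℕ) :
    ∫ x in Ioi (0 : ℝ), (laguerrePoly k ^ 2).eval x * Real.exp (-x) = 1 := by
  have h1 : ∀ x : ℝ, (laguerrePoly k ^ 2).eval x * Real.exp (-x) =
      ∑ j ∈ Finset.range (k + 1), (laguerrePoly k).coeff j *
        ((Polynomial.X ^ j * laguerrePoly k).eval x * Real.exp (-x)) := by
    intro x
    rw [pow_two, Polynomial.eval_mul]
    nth_rw 1 [Polynomial.eval_eq_sum_range' (natDegree_laguerrePoly_lt k)]
    simp only [Polynomial.eval_mul, Polynomial.eval_pow, Polynomial.eval_X, Finset.sum_mul]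
    refine Finset.sum_congr rfl fun i _ => ?_
    ring
  simp_rw [h1]
  rw [integral_finsetSum]
  · simp_rw [integral_const_mul, integral_pow_mul_laguerrePoly]
    rw [Finset.sum_range_succ, Finset.sum_eq_zero, zero_add, laguerrePoly_coeff,
      if_pos (Nat.lt_succ_self k)]
    · have h := Polynomial.fwdDiff_iter_degree_eq_factorial (ascPochhammer ℝ k)
      rw [ascPochhammer_natDegree, (monic_ascPochhammer ℝ k).leadingCoeff] at h
      have h5 : (k.factorial : ℝ) ≠ 0 := by positivity
      have h6 : ((-1 : ℝ) ^ k) * (-1) ^ k = 1 := by rw [← mul_pow]; simp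
      rw [h]
      simp only [one_smul, Pi.natCast_apply, Nat.choose_self, Nat.cast_one, mul_one]
      field_simp
      linarith
    · intro j hj
      rw [Polynomial.fwdDiff_iter_eq_zero_of_degree_lt]
      · simp
      · rw [ascPochhammer_natDegree]
        exact Finset.mem_range.mp hj
  · intro j _
    exact (integrableOn_poly_mul_exp _).const_mul _

theorem laguerreFun_sq (k : ℕ) (y : ℝ) :
    laguerreFun k y ^ 2 = (laguerrePoly k ^ 2).eval y * Real.exp (-y) := by
  have he : Real.exp (-y) = Real.exp (-y / 2) ^ 2 := by
    rw [← Real.exp_nat_mul]; congr 1; push_cast; ring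
  rw [laguerreFun, he, Polynomial.eval_pow]
  ring

theorem integrableOn_laguerreFun_sq (k : ℕ) :
    IntegrableOn (fun y => laguerreFun k y ^ 2) (Ioi 0) := by
  simp_rw [laguerreFun_sq]
  exact integrableOn_poly_mul_exp _

theorem integral_laguerreFun_sq (k : ℕ) : ∫ y in Ioi (0 : ℝ), laguerreFun k y ^ 2 = 1 := by
  simp_rw [laguerreFun_sq]
  exact integral_laguerrePoly_sq k

theorem lintegral_laguerreFun_sq (k : ℕ) :
    ∫⁻ y in Ioi (0 : ℝ), ENNReal.ofReal (laguerreFun k y ^ 2) = 1 := by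
  rw [← ofReal_integral_eq_lintegral_ofReal (integrableOn_laguerreFun_sq k)
    (ae_of_all _ fun y => sq_nonneg _), integral_laguerreFun_sq, ENNReal.ofReal_one]

/-! ### The Fourier transform on `L₁ ∩ L₂` -/

theorem integral_smul_fourierInv {h : ℝ → ℂ} (h1 : Integrable h) (φ : SchwartzMap ℝ ℂ) :
    ∫ x, φ x • 𝓕⁻ h x = ∫ x, (𝓕⁻ φ : SchwartzMap ℝ ℂ) x • h x := by
  have hc : Continuous fun p : ℝ × ℝ => (-innerₗ ℝ) p.1 p.2 := by
    simp only [LinearMap.neg_apply, innerₗ_apply_apply]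
    fun_prop
  have hflip : (-innerₗ ℝ : ℝ →ₗ[ℝ] ℝ →ₗ[ℝ] ℝ).flip = -innerₗ ℝ := by
    ext; simp
  -- The negated pairing makes the general Fourier integral the inverse transform on both sides.
  have := VectorFourier.integral_fourierIntegral_smul_eq_flip (μ := volume) (ν := volume)
    (L := -innerₗ ℝ) Real.continuous_fourierChar hc φ.integrable h1
  rw [hflip] at this
  rw [SchwartzMap.fourierInv_coe]
  exact this.symm

/-- The `L₂` transform agrees with the distributional one, and by Fubini so does the integral. Both
sides therefore have the same pairings with smooth compactly supported functions. This is the bridge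
between the abstract unitary and concrete integrals. -/
theorem coeFn_fourier_symm_toLp {h : ℝ → ℂ} (h1 : Integrable h) (h2 : MemLp h 2 volume) :
    ((Lp.fourierTransformₗᵢ ℝ ℂ).symm (h2.toLp h) : ℝ → ℂ) =ᵐ[volume] 𝓕⁻ h := by
  have hcont : Continuous (𝓕⁻ h) := by
    rw [Real.fourierInv_eq_fourier_comp_neg]
    exact VectorFourier.fourierIntegral_continuous Real.continuous_fourierChar
      (innerSL ℝ).continuous₂ h1.comp_neg
  refine ae_eq_of_integral_contDiff_smul_eq ((Lp.memLp _).locallyIntegrable (by norm_num))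
    hcont.locallyIntegrable fun g g_smooth g_cpt => ?_
  have hg₁ : HasCompactSupport (Complex.ofRealCLM ∘ g) := g_cpt.comp_left rfl
  have hg₂ : ContDiff ℝ (⊤ : ℕ∞) (Complex.ofRealCLM ∘ g) := by fun_prop
  let φ : SchwartzMap ℝ ℂ := hg₁.toSchwartzMap hg₂
  have e1 : ∫ x, φ x • ((Lp.fourierTransformₗᵢ ℝ ℂ).symm (h2.toLp h) : ℝ → ℂ) x =
      ∫ x, (𝓕⁻ φ : SchwartzMap ℝ ℂ) x • h x := by
    have := congrArg (fun T => T φ) (Lp.fourierInv_toTemperedDistribution_eq (h2.toLp h))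
    simp only [TemperedDistribution.fourierInv_apply, Lp.toTemperedDistribution_apply] at this
    refine this.symm.trans (integral_congr_ae ?_)
    filter_upwards [h2.coeFn_toLp] with x hx
    rw [hx]
  have e2 := e1.trans (integral_smul_fourierInv h1 φ).symm
  simpa [φ] using e2

/-! ### Integration on `ℝ_+` and on `G` -/

theorem map_mul_left_restrict_Ioi {c : ℝ} (hc : 0 < c) :
    Measure.map (fun v => c * v) ((volume : Measure ℝ).restrict (Ioi 0)) =
      ENNReal.ofReal c⁻¹ • (volume : Measure ℝ).restrict (Ioi 0) := by
  have h : (fun v => c * v) ⁻¹' Ioi (0 : ℝ) = Ioi 0 := by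
    ext v; simp [hc]
  have := Measure.restrict_map (μ := (volume : Measure ℝ)) (f := fun v => c * v)
    (by fun_prop) (measurableSet_Ioi (a := (0 : ℝ)))
  rw [h, Real.map_volume_mul_left hc.ne'] at this
  rw [← this, abs_of_pos (inv_pos.2 hc), Measure.restrict_smul]

theorem measurableEmbedding_mul_left {c : ℝ} (hc : 0 < c) :
    MeasurableEmbedding (fun v : ℝ => c * v) :=
  (Homeomorph.mulLeft₀ c hc.ne').measurableEmbedding

theorem lintegral_comp_mul_left_Ioi {c : ℝ} (hc : 0 < c) (g : ℝ → ℝ≥0∞) :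
    ∫⁻ v in Ioi (0 : ℝ), g (c * v) = ENNReal.ofReal c⁻¹ * ∫⁻ y in Ioi (0 : ℝ), g y := by
  rw [← (measurableEmbedding_mul_left hc).lintegral_map g, map_mul_left_restrict_Ioi hc,
    lintegral_smul_measure, smul_eq_mul]

theorem quasiMeasurePreserving_mul_left_Ioi {c : ℝ} (hc : 0 < c) :
    Measure.QuasiMeasurePreserving (fun v => c * v) ((volume : Measure ℝ).restrict (Ioi 0))
      ((volume : Measure ℝ).restrict (Ioi 0)) := by
  refine ⟨by fun_prop, ?_⟩
  rw [map_mul_left_restrict_Ioi hc]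
  exact Measure.smul_absolutelyContinuous

/-- Carries almost-everywhere statements about v to statements about v / (2ξ), for each fixed ξ > 0.
-/
theorem quasiMeasurePreserving_div_Ioi {c : ℝ} (hc : 0 < c) :
    Measure.QuasiMeasurePreserving (fun v => v / c) ((volume : Measure ℝ).restrict (Ioi 0))
      ((volume : Measure ℝ).restrict (Ioi 0)) := by
  simpa [div_eq_inv_mul] using quasiMeasurePreserving_mul_left_Ioi (inv_pos.2 hc)

theorem nuPlus_absolutelyContinuous : nuPlus ≪ (volume : Measure ℝ).restrict (Ioi 0) :=
  withDensity_absolutelyContinuous _ _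

theorem absolutelyContinuous_nuPlus : (volume : Measure ℝ).restrict (Ioi 0) ≪ nuPlus := by
  refine withDensity_absolutelyContinuous' (by fun_prop) ?_
  filter_upwards [ae_restrict_mem measurableSet_Ioi] with v (hv : 0 < v)
  simp only [ne_eq, ENNReal.ofReal_eq_zero, not_le]
  positivity

theorem ae_nuPlus_pos : ∀ᵐ v ∂nuPlus, 0 < v :=
  nuPlus_absolutelyContinuous.ae_le (ae_restrict_mem measurableSet_Ioi)

theorem lintegral_nuPlus (g : ℝ → ℝ≥0∞) :
    ∫⁻ v, g v ∂nuPlus = ∫⁻ v in Ioi (0 : ℝ), ENNReal.ofReal ((v ^ 2)⁻¹) * g v := by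
  rw [nuPlus, lintegral_withDensity_eq_lintegral_mul_non_measurable _ (by fun_prop)
    (ae_of_all _ fun _ => ENNReal.ofReal_lt_top)]
  rfl

theorem integral_nuPlus (g : ℝ → ℂ) :
    ∫ v, g v ∂nuPlus = ∫ v in Ioi (0 : ℝ), (((v ^ 2)⁻¹ : ℝ) : ℂ) * g v := by
  rw [nuPlus, integral_withDensity_eq_integral_toReal_smul (by fun_prop)
    (ae_of_all _ fun _ => ENNReal.ofReal_lt_top)]
  refine integral_congr_ae (ae_of_all _ fun v => ?_)
  simp only
  rw [ENNReal.toReal_ofReal (by positivity), Complex.real_smul]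

theorem ae_nu_of_forall_pos {p : ℝ × ℝ → Prop} (h : ∀ u v, 0 < v → p (u, v)) :
    ∀ᵐ ζ ∂nu, p ζ := by
  filter_upwards [ae_nu_pos] with ζ hζ using h ζ.1 ζ.2 hζ

theorem ae_ae_of_ae_nu {p : ℝ × ℝ → Prop} (h : ∀ᵐ ζ ∂nu, p ζ) :
    ∀ᵐ v ∂nuPlus, ∀ᵐ u, p (u, v) := by
  have h' : ∀ᵐ ζ ∂(nuPlus.prod volume), p ζ.swap :=
    Measure.measurePreserving_swap.quasiMeasurePreserving.ae h
  exact Measure.ae_ae_of_ae_prod h'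

theorem aestronglyMeasurable_comp_snd_nu {a : ℝ → ℂ}
    (ha : AEStronglyMeasurable a ((volume : Measure ℝ).restrict (Ioi 0))) :
    AEStronglyMeasurable (fun ζ : ℝ × ℝ => a ζ.2) nu :=
  (ha.mono_ac nuPlus_absolutelyContinuous).comp_snd

/-! ### The horizontal Fourier transform of the wavelet transform -/

theorem stronglyMeasurable_waveletHat (k : ℕ) : StronglyMeasurable (waveletHat k) := by
  have hc : Continuous fun ξ : ℝ => ((√(2 * ξ) * laguerreFun k (2 * ξ) : ℝ) : ℂ) := by
    have := continuous_laguerreFun k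
    fun_prop
  exact hc.stronglyMeasurable.indicator measurableSet_Ioi

theorem integrable_waveletHat (k : ℕ) : Integrable (waveletHat k) := by
  unfold waveletHat
  rw [integrable_indicator_iff measurableSet_Ioi]
  have hc : Continuous fun ξ : ℝ => ((√(2 * ξ) * laguerreFun k (2 * ξ) : ℝ) : ℂ) := by
    have := continuous_laguerreFun k
    fun_prop
  -- The bound √(2x) ≤ 1 + 2x reduces to a polynomial times exp(-x).
  refine Integrable.mono (integrableOn_poly_mul_exp ((1 + Polynomial.C 2 * Polynomial.X) *
    (laguerrePoly k).comp (Polynomial.C 2 * Polynomial.X))) hc.aestronglyMeasurable ?_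
  filter_upwards [ae_restrict_mem measurableSet_Ioi] with x (hx : 0 < x)
  have h1 : √(2 * x) ≤ 1 + 2 * x := by
    rw [Real.sqrt_le_left (by positivity)]
    nlinarith
  have h2 : -(2 * x) / 2 = -x := by ring
  simp only [Complex.norm_real, laguerreFun, Polynomial.eval_mul, Polynomial.eval_add,
    Polynomial.eval_one, Polynomial.eval_C, Polynomial.eval_X, Polynomial.eval_comp, norm_mul, h2]
  rw [Real.norm_of_nonneg (Real.sqrt_nonneg _), Real.norm_of_nonneg (by positivity : 0 ≤ 1 + 2 * x)]
  calc √(2 * x) * (‖Real.exp (-x)‖ * ‖(laguerrePoly k).eval (2 * x)‖)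
      ≤ (1 + 2 * x) * (‖Real.exp (-x)‖ * ‖(laguerrePoly k).eval (2 * x)‖) := by gcongr
    _ = _ := by ring

/-- The Fourier transform in the horizontal variable of `bargmannInv k f`. -/
noncomputable def horizontalHat (k : ℕ) (f : ℝ → ℂ) (ζ : ℝ × ℝ) : ℂ :=
  ((√ζ.2 : ℝ) : ℂ) * waveletHat k (ζ.2 * ζ.1) * f ζ.1

theorem horizontalHat_of_pos (k : ℕ) (f : ℝ → ℂ) {ξ v : ℝ} (hξ : 0 < ξ) (hv : 0 < v) :
    horizontalHat k f (ξ, v) =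
      ((√2 * v * √ξ * laguerreFun k (2 * ξ * v) : ℝ) : ℂ) * f ξ := by
  have h1 : v * ξ ∈ Ioi (0 : ℝ) := mul_pos hv hξ
  have h2 : √v * √(2 * (v * ξ)) = √2 * v * √ξ := by
    rw [Real.sqrt_mul (by norm_num), Real.sqrt_mul hv.le]
    nth_rw 3 [← Real.mul_self_sqrt hv.le]
    ring
  rw [horizontalHat, waveletHat, indicator_of_mem h1, ← Complex.ofReal_mul, ← mul_assoc, h2]
  congr 4
  ring

theorem horizontalHat_of_nonpos (k : ℕ) (f : ℝ → ℂ) {ξ v : ℝ} (hξ : ξ ≤ 0) (hv : 0 < v) :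
    horizontalHat k f (ξ, v) = 0 := by
  have h1 : v * ξ ∉ Ioi (0 : ℝ) := not_lt.2 (mul_nonpos_of_nonneg_of_nonpos hv.le hξ)
  rw [horizontalHat, waveletHat, indicator_of_notMem h1, mul_zero, zero_mul]

theorem stronglyMeasurable_horizontalHat (k : ℕ) {f : ℝ → ℂ} (hf : StronglyMeasurable f) :
    StronglyMeasurable (horizontalHat k f) := by
  unfold horizontalHat
  refine StronglyMeasurable.mul (StronglyMeasurable.mul ?_ ?_) ?_
  · exact (by fun_prop : Continuous fun ζ : ℝ × ℝ => ((√ζ.2 : ℝ) : ℂ)).stronglyMeasurable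
  · exact (stronglyMeasurable_waveletHat k).comp_measurable (by fun_prop)
  · exact hf.comp_measurable measurable_fst

theorem bargmannInv_eq_fourierInv (k : ℕ) (f : ℝ → ℂ) (u : ℝ) {v : ℝ} (hv : 0 < v) :
    bargmannInv k f (u, v) = 𝓕⁻ (fun ξ => horizontalHat k f (ξ, v)) u := by
  rw [Real.fourierInv_eq', bargmannInv, ← integral_const_mul,
    ← integral_indicator measurableSet_Ioi]
  refine integral_congr_ae (ae_of_all _ fun ξ => ?_)
  by_cases hξ : 0 < ξ
  · simp only [mem_Ioi, hξ, indicator_of_mem, horizontalHat_of_pos k f hξ hv, smul_eq_mul]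
    rw [show 2 * (Real.pi : ℂ) * Complex.I * ξ * u =
      ((2 * Real.pi * inner ℝ ξ u : ℝ) : ℂ) * Complex.I by
        simp only [RCLike.inner_apply, conj_trivial]; push_cast; ring]
    push_cast
    ring
  · simp only [mem_Ioi, hξ, not_false_eq_true, indicator_of_notMem,
      horizontalHat_of_nonpos k f (not_lt.1 hξ) hv, smul_zero]

theorem memLp_waveletHat_comp_mul (k : ℕ) {v : ℝ} (hv : 0 < v) :
    MemLp (fun ξ => waveletHat k (v * ξ)) 2 volume := by
  have h1 : MemLp (waveletHat k) 2 (Measure.map (fun u : ℝ => v * u) volume) := by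
    rw [Real.map_volume_mul_left hv.ne']
    exact (memLp_waveletHat k).smul_measure ENNReal.ofReal_ne_top
  simpa [Function.comp_def] using h1.comp_of_map (by fun_prop)

/-- Cauchy–Schwarz gives this for every v > 0, whereas square integrability of the slice is only
obtained for almost every v. -/
theorem integrable_horizontalHat (k : ℕ) {f : ℝ → ℂ} (hf : MemLp f 2 (volume.restrict (Ioi 0)))
    {v : ℝ} (hv : 0 < v) : Integrable fun ξ => horizontalHat k f (ξ, v) := by
  have h : Integrable (fun ξ => waveletHat k (v * ξ) * f ξ) (volume.restrict (Ioi 0)) :=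
    ((memLp_waveletHat_comp_mul k hv).restrict _).integrable_mul hf
  have h2 := (integrable_indicator_iff measurableSet_Ioi).2 (h.const_mul ((√v : ℝ) : ℂ))
  refine h2.congr (ae_of_all _ fun ξ => ?_)
  by_cases hξ : 0 < ξ
  · simp [hξ, horizontalHat, mul_assoc]
  · simp [hξ, horizontalHat_of_nonpos k f (not_lt.1 hξ) hv]

/-- Tonelli with ξ outside and y = 2ξv inside: the density `v⁻²` turns the squared profile into `2ξ
ℓ_k(2ξv)²`, and 2ξ dv = dy. The weight b = 1 yields the isometry, b = |a|² the domain of the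
Toeplitz operator. -/
theorem lintegral_horizontalHat (k : ℕ) {f : ℝ → ℂ} (hf : StronglyMeasurable f) {b : ℝ → ℝ≥0∞}
    (hb : AEMeasurable b ((volume : Measure ℝ).restrict (Ioi 0))) :
    ∫⁻ ζ, b ζ.2 * ‖horizontalHat k f ζ‖ₑ ^ 2 ∂nu =
      ∫⁻ ξ in Ioi (0 : ℝ), (∫⁻ y in Ioi (0 : ℝ),
        b (y / (2 * ξ)) * ENNReal.ofReal (laguerreFun k y ^ 2)) * ‖f ξ‖ₑ ^ 2 := by
  rw [nu, lintegral_prod, ← lintegral_indicator measurableSet_Ioi]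
  · refine lintegral_congr fun ξ => ?_
    rw [lintegral_nuPlus]
    by_cases hξ : 0 < ξ
    · rw [indicator_of_mem (show ξ ∈ Ioi (0 : ℝ) from hξ), ← lintegral_mul_const']
      swap; · finiteness
      have h2 : 0 < 2 * ξ := by positivity
      set g : ℝ → ℝ≥0∞ := fun y =>
        b (y / (2 * ξ)) * ENNReal.ofReal (laguerreFun k y ^ 2) * ‖f ξ‖ₑ ^ 2 with hg
      have h3 := lintegral_comp_mul_left_Ioi h2 g
      have h4 : ∫⁻ y in Ioi (0 : ℝ), g y =
          ENNReal.ofReal (2 * ξ) * ∫⁻ v in Ioi (0 : ℝ), g (2 * ξ * v) := by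
        rw [h3, ← mul_assoc, ← ENNReal.ofReal_mul h2.le, mul_inv_cancel₀ h2.ne',
          ENNReal.ofReal_one, one_mul]
      rw [h4, ← lintegral_const_mul' _ _ ENNReal.ofReal_ne_top]
      refine setLIntegral_congr_fun measurableSet_Ioi fun v (hv : 0 < v) => ?_
      have h5 : 2 * ξ * v / (2 * ξ) = v := by field_simp
      have h6 : ENNReal.ofReal ((v ^ 2)⁻¹) *
          ‖((√2 * v * √ξ * laguerreFun k (2 * ξ * v) : ℝ) : ℂ)‖ₑ ^ 2 =
          ENNReal.ofReal (2 * ξ) * ENNReal.ofReal (laguerreFun k (2 * ξ * v) ^ 2) := by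
        rw [← ofReal_norm, Complex.norm_real, ← ENNReal.ofReal_pow (norm_nonneg _),
          Real.norm_eq_abs, sq_abs, ← ENNReal.ofReal_mul (by positivity),
          ← ENNReal.ofReal_mul h2.le]
        congr 1
        simp only [mul_pow, Real.sq_sqrt hξ.le, Real.sq_sqrt zero_le_two]
        field_simp
      simp only [hg, h5, horizontalHat_of_pos k f hξ hv, enorm_mul, mul_pow]
      calc _ = b v * (ENNReal.ofReal ((v ^ 2)⁻¹) *
          ‖((√2 * v * √ξ * laguerreFun k (2 * ξ * v) : ℝ) : ℂ)‖ₑ ^ 2) * ‖f ξ‖ₑ ^ 2 := by ring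
        _ = _ := by rw [h6]; ring
    · rw [indicator_of_notMem (by simpa using hξ), ← lintegral_zero]
      refine setLIntegral_congr_fun measurableSet_Ioi fun v (hv : 0 < v) => ?_
      simp [horizontalHat_of_nonpos k f (not_lt.1 hξ) hv]
  · refine AEMeasurable.mul (hb.mono_ac nuPlus_absolutelyContinuous).comp_snd ?_
    exact ((stronglyMeasurable_horizontalHat k hf).enorm.pow_const 2).aemeasurable

theorem lintegral_horizontalHat_sq (k : ℕ) {f : ℝ → ℂ} (hf : StronglyMeasurable f) :
    ∫⁻ ζ, ‖horizontalHat k f ζ‖ₑ ^ 2 ∂nu = ∫⁻ ξ in Ioi (0 : ℝ), ‖f ξ‖ₑ ^ 2 := by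
  have := lintegral_horizontalHat k hf (b := fun _ => 1) aemeasurable_const
  simpa [lintegral_laguerreFun_sq] using this

/-! ### Plancherel's theorem for `bargmannInv` -/

theorem eLpNorm_two_eq {α : Type*} [MeasurableSpace α] {μ : Measure α} (f : α → ℂ) :
    eLpNorm f 2 μ = (∫⁻ x, ‖f x‖ₑ ^ 2 ∂μ) ^ (1 / 2 : ℝ) := by
  rw [eLpNorm_eq_lintegral_rpow_enorm_toReal (by norm_num) (by norm_num)]
  simp

theorem lintegral_enorm_sq_eq_eLpNorm_sq {α : Type*} [MeasurableSpace α] {μ : Measure α} (f : α → ℂ) :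
    ∫⁻ x, ‖f x‖ₑ ^ 2 ∂μ = eLpNorm f 2 μ ^ 2 := by
  rw [eLpNorm_two_eq, ← ENNReal.rpow_natCast, ← ENNReal.rpow_mul]
  simp

theorem memLp_two_iff_lintegral {α : Type*} [MeasurableSpace α] {μ : Measure α} {f : α → ℂ}
    (hf : AEStronglyMeasurable f μ) : MemLp f 2 μ ↔ ∫⁻ x, ‖f x‖ₑ ^ 2 ∂μ < ∞ := by
  rw [lintegral_enorm_sq_eq_eLpNorm_sq, ENNReal.pow_lt_top_iff]
  simp [MemLp, hf]

theorem memLp_horizontalHat (k : ℕ) {f : ℝ → ℂ} (hf : StronglyMeasurable f)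
    (hf2 : MemLp f 2 (volume.restrict (Ioi 0))) : MemLp (horizontalHat k f) 2 nu := by
  rw [memLp_two_iff_lintegral (stronglyMeasurable_horizontalHat k hf).aestronglyMeasurable,
    lintegral_horizontalHat_sq k hf]
  exact (memLp_two_iff_lintegral hf2.1).1 hf2

theorem ae_memLp_horizontalHat (k : ℕ) {f : ℝ → ℂ} (hf : StronglyMeasurable f)
    (hf2 : MemLp f 2 (volume.restrict (Ioi 0))) :
    ∀ᵐ v ∂nuPlus, MemLp (fun ξ => horizontalHat k f (ξ, v)) 2 volume := by
  have hm := stronglyMeasurable_horizontalHat k hf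
  have h := (memLp_two_iff_lintegral hm.aestronglyMeasurable).1 (memLp_horizontalHat k hf hf2)
  rw [nu, lintegral_prod_symm _ (hm.enorm.pow_const 2).aemeasurable] at h
  have h2 := ae_lt_top (hm.enorm.pow_const 2).lintegral_prod_left' h.ne
  filter_upwards [h2] with v hv
  rw [memLp_two_iff_lintegral]
  · exact hv
  · exact (hm.comp_measurable (by fun_prop : Measurable fun ξ : ℝ => (ξ, v))).aestronglyMeasurable

theorem ae_bargmannInv_eq_fourier_symm (k : ℕ) {f : ℝ → ℂ} (hf : StronglyMeasurable f)
    (hf2 : MemLp f 2 (volume.restrict (Ioi 0))) :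
    ∀ᵐ v ∂nuPlus, ∃ h : MemLp (fun ξ => horizontalHat k f (ξ, v)) 2 volume,
      ((Lp.fourierTransformₗᵢ ℝ ℂ).symm (h.toLp _) : ℝ → ℂ) =ᵐ[volume]
        fun u => bargmannInv k f (u, v) := by
  filter_upwards [ae_memLp_horizontalHat k hf hf2, ae_nuPlus_pos] with v hv hpos
  refine ⟨hv, ?_⟩
  filter_upwards [coeFn_fourier_symm_toLp (integrable_horizontalHat k hf2 hpos) hv] with u hu
  rw [hu, bargmannInv_eq_fourierInv k f u hpos]

theorem stronglyMeasurable_bargmannInv (k : ℕ) {f : ℝ → ℂ} (hf : StronglyMeasurable f) :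
    StronglyMeasurable (bargmannInv k f) := by
  have hl := continuous_laguerreFun k
  refine StronglyMeasurable.mul
    (by fun_prop : Continuous fun ζ : ℝ × ℝ => ((√2 * ζ.2 : ℝ) : ℂ)).stronglyMeasurable ?_
  refine StronglyMeasurable.integral_prod_right (f := fun ζ : ℝ × ℝ => fun ξ : ℝ =>
    f ξ * ((laguerreFun k (2 * ξ * ζ.2) : ℝ) : ℂ) *
      Complex.exp (2 * Real.pi * Complex.I * ξ * ζ.1) * ((√ξ : ℝ) : ℂ)) ?_
  have h1 : StronglyMeasurable fun p : (ℝ × ℝ) × ℝ => f p.2 := hf.comp_measurable measurable_snd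
  have h2 : Continuous fun p : (ℝ × ℝ) × ℝ => ((laguerreFun k (2 * p.2 * p.1.2) : ℝ) : ℂ) := by
    fun_prop
  have h3 : Continuous fun p : (ℝ × ℝ) × ℝ =>
      Complex.exp (2 * Real.pi * Complex.I * p.2 * p.1.1) := by fun_prop
  have h4 : Continuous fun p : (ℝ × ℝ) × ℝ => ((√p.2 : ℝ) : ℂ) := by fun_prop
  exact ((h1.mul h2.stronglyMeasurable).mul h3.stronglyMeasurable).mul h4.stronglyMeasurable

/-- The weight is constant on each line v = const, so Plancherel on almost every such line reduces
this to `lintegral_horizontalHat`. -/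
theorem lintegral_bargmannInv (k : ℕ) {f : ℝ → ℂ} (hf : StronglyMeasurable f)
    (hf2 : MemLp f 2 (volume.restrict (Ioi 0))) {b : ℝ → ℝ≥0∞}
    (hb : AEMeasurable b ((volume : Measure ℝ).restrict (Ioi 0))) :
    ∫⁻ ζ, b ζ.2 * ‖bargmannInv k f ζ‖ₑ ^ 2 ∂nu =
      ∫⁻ ξ in Ioi (0 : ℝ), (∫⁻ y in Ioi (0 : ℝ),
        b (y / (2 * ξ)) * ENNReal.ofReal (laguerreFun k y ^ 2)) * ‖f ξ‖ₑ ^ 2 := by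
  have hb' : AEMeasurable (fun ζ : ℝ × ℝ => b ζ.2) nu :=
    (hb.mono_ac nuPlus_absolutelyContinuous).comp_snd
  have hm1 := (stronglyMeasurable_bargmannInv k hf)
  have hm2 := (stronglyMeasurable_horizontalHat k hf)
  rw [← lintegral_horizontalHat k hf hb]
  have e1 := lintegral_prod_symm _ (hb'.mul (hm1.enorm.pow_const 2).aemeasurable)
  have e2 := lintegral_prod_symm _ (hb'.mul (hm2.enorm.pow_const 2).aemeasurable)
  refine e1.trans (Eq.trans ?_ e2.symm)
  refine lintegral_congr_ae ?_
  filter_upwards [ae_bargmannInv_eq_fourier_symm k hf hf2] with v ⟨hv, hv'⟩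
  have hs : Measurable fun u : ℝ => (u, v) := by fun_prop
  have hm1' : Measurable fun u => ‖bargmannInv k f (u, v)‖ₑ ^ 2 := (hm1.enorm.pow_const 2).comp hs
  have hm2' : Measurable fun u => ‖horizontalHat k f (u, v)‖ₑ ^ 2 :=
    (hm2.enorm.pow_const 2).comp hs
  simp only [Pi.mul_apply]
  rw [lintegral_const_mul _ hm1', lintegral_const_mul _ hm2']
  congr 1
  rw [lintegral_enorm_sq_eq_eLpNorm_sq, lintegral_enorm_sq_eq_eLpNorm_sq, ← eLpNorm_congr_ae hv',
    ← eLpNorm_congr_ae hv.coeFn_toLp, ← Lp.enorm_def, ← Lp.enorm_def,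
    ← ofReal_norm, ← ofReal_norm, LinearIsometryEquiv.norm_map]

theorem lintegral_bargmannInv_sq (k : ℕ) {f : ℝ → ℂ} (hf : StronglyMeasurable f)
    (hf2 : MemLp f 2 (volume.restrict (Ioi 0))) :
    ∫⁻ ζ, ‖bargmannInv k f ζ‖ₑ ^ 2 ∂nu = ∫⁻ ξ in Ioi (0 : ℝ), ‖f ξ‖ₑ ^ 2 := by
  have := lintegral_bargmannInv k hf hf2 (b := fun _ => 1) aemeasurable_const
  simpa [lintegral_laguerreFun_sq] using this

theorem memLp_bargmannInv (k : ℕ) {f : ℝ → ℂ} (hf : StronglyMeasurable f)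
    (hf2 : MemLp f 2 (volume.restrict (Ioi 0))) : MemLp (bargmannInv k f) 2 nu := by
  rw [memLp_two_iff_lintegral (stronglyMeasurable_bargmannInv k hf).aestronglyMeasurable,
    lintegral_bargmannInv_sq k hf hf2]
  exact (memLp_two_iff_lintegral hf2.1).1 hf2

theorem bargmannInv_congr_ae (k : ℕ) {f g : ℝ → ℂ} (h : f =ᵐ[volume.restrict (Ioi 0)] g) :
    bargmannInv k f = bargmannInv k g := by
  ext ζ
  simp only [bargmannInv]
  congr 1
  refine integral_congr_ae ?_
  filter_upwards [h] with ξ hξ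
  rw [hξ]

theorem integrable_bargmannInv_integrand (k : ℕ) {f : ℝ → ℂ}
    (hf : MemLp f 2 (volume.restrict (Ioi 0))) (u : ℝ) {v : ℝ} (hv : 0 < v) :
    Integrable (fun ξ : ℝ => f ξ * ((laguerreFun k (2 * ξ * v) : ℝ) : ℂ) *
      Complex.exp (2 * Real.pi * Complex.I * ξ * u) * ((√ξ : ℝ) : ℂ))
      (volume.restrict (Ioi 0)) := by
  -- The forward Fourier kernel at -u is exp(2πiξu).
  have h := (Real.fourierIntegral_convergent_iff (-u)).2 (integrable_horizontalHat k hf hv)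
  have h2 := (h.restrict (s := Ioi 0)).const_mul (((√2 * v)⁻¹ : ℝ) : ℂ)
  have hne : ((√2 : ℝ) : ℂ) ≠ 0 := by simp
  have hne' : (v : ℂ) ≠ 0 := by simpa using hv.ne'
  refine h2.congr ?_
  filter_upwards [ae_restrict_mem measurableSet_Ioi] with ξ (hξ : 0 < ξ)
  rw [horizontalHat_of_pos k f hξ hv, Circle.smul_def, Real.fourierChar_apply, smul_eq_mul,
    show 2 * (Real.pi : ℂ) * Complex.I * ξ * u =
      ((2 * Real.pi * (-inner ℝ ξ (-u)) : ℝ) : ℂ) * Complex.I by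
        simp only [RCLike.inner_apply, conj_trivial]; push_cast; ring]
  push_cast
  field_simp

theorem bargmannInv_add (k : ℕ) {f g : ℝ → ℂ} (hf : MemLp f 2 (volume.restrict (Ioi 0)))
    (hg : MemLp g 2 (volume.restrict (Ioi 0))) (u : ℝ) {v : ℝ} (hv : 0 < v) :
    bargmannInv k (f + g) (u, v) = bargmannInv k f (u, v) + bargmannInv k g (u, v) := by
  simp only [bargmannInv, Pi.add_apply, add_mul]
  rw [integral_add (integrable_bargmannInv_integrand k hf u hv)
    (integrable_bargmannInv_integrand k hg u hv), mul_add]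

theorem bargmannInv_smul (k : ℕ) (c : ℂ) (f : ℝ → ℂ) (ζ : ℝ × ℝ) :
    bargmannInv k (c • f) ζ = c * bargmannInv k f ζ := by
  simp only [bargmannInv, Pi.smul_apply, smul_eq_mul, mul_assoc]
  rw [integral_const_mul]
  ring

theorem memLp_bargmannInv_Lp (k : ℕ) (f : L2Plus) : MemLp (bargmannInv k f) 2 nu :=
  memLp_bargmannInv k (Lp.stronglyMeasurable f) (Lp.memLp f)

/-- The isometry `R_k^*` of `L₂(ℝ_+)` into `L₂(G, dν)`. -/
noncomputable def bargmannInvₗᵢ (k : ℕ) : L2Plus →ₗᵢ[ℂ] L2G where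
  toFun f := (memLp_bargmannInv_Lp k f).toLp _
  map_add' f g := by
    rw [← MemLp.toLp_add, MemLp.toLp_eq_toLp_iff, bargmannInv_congr_ae k (Lp.coeFn_add f g)]
    exact ae_nu_of_forall_pos fun u v hv => bargmannInv_add k (Lp.memLp f) (Lp.memLp g) u hv
  map_smul' c f := by
    rw [RingHom.id_apply, ← MemLp.toLp_const_smul, MemLp.toLp_eq_toLp_iff,
      bargmannInv_congr_ae k (Lp.coeFn_smul c f)]
    exact ae_of_all _ fun ζ => bargmannInv_smul k c f ζ
  norm_map' f := by
    change ‖(memLp_bargmannInv_Lp k f).toLp _‖ = ‖f‖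
    rw [Lp.norm_toLp, Lp.norm_def, eLpNorm_two_eq, eLpNorm_two_eq,
      lintegral_bargmannInv_sq k (Lp.stronglyMeasurable f) (Lp.memLp f)]

theorem coeFn_bargmannInvₗᵢ (k : ℕ) (f : L2Plus) :
    bargmannInvₗᵢ k f =ᵐ[nu] bargmannInv k f :=
  (memLp_bargmannInv_Lp k f).coeFn_toLp

/-! ### The wavelet transform as `R_k^*` of the Fourier transform -/

theorem coeFn_wavelet (k : ℕ) : (wavelet k : ℝ → ℂ) =ᵐ[volume] 𝓕⁻ (waveletHat k) :=
  coeFn_fourier_symm_toLp (integrable_waveletHat k) (memLp_waveletHat k)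

theorem conj_waveletHat (k : ℕ) (ξ : ℝ) :
    (starRingEnd ℂ) (waveletHat k ξ) = waveletHat k ξ := by
  by_cases hξ : ξ ∈ Ioi (0 : ℝ)
  · simp only [waveletHat, indicator_of_mem hξ, Complex.conj_ofReal]
  · simp only [waveletHat, indicator_of_notMem hξ, map_zero]

theorem quasiMeasurePreserving_sub_div (u : ℝ) {v : ℝ} (hv : 0 < v) :
    Measure.QuasiMeasurePreserving (fun t : ℝ => (u - t) / v) := by
  have h1 : Measure.QuasiMeasurePreserving (fun t : ℝ => t * v⁻¹) := by
    refine ⟨by fun_prop, ?_⟩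
    rw [Real.map_volume_mul_right (inv_ne_zero hv.ne')]
    exact Measure.smul_absolutelyContinuous
  have h2 := (Measure.measurePreserving_sub_left (volume : Measure ℝ) u).quasiMeasurePreserving
  simpa [Function.comp_def, div_eq_mul_inv] using h1.comp h2

/-- The complex conjugate of the Fourier transform of `t ↦ conj (ψ_v (u - t))`. -/
noncomputable def conjDilateHat (k : ℕ) (u v ξ : ℝ) : ℂ :=
  ((√v : ℝ) : ℂ) * (Real.fourierChar (-inner ℝ ξ u) • waveletHat k (v * ξ))

theorem integrable_conjDilateHat (k : ℕ) (u : ℝ) {v : ℝ} (hv : 0 < v) :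
    Integrable (conjDilateHat k u v) :=
  ((Real.fourierIntegral_convergent_iff u).2
    ((integrable_waveletHat k).comp_mul_left' hv.ne')).const_mul _

theorem memLp_conjDilateHat (k : ℕ) (u : ℝ) {v : ℝ} (hv : 0 < v) :
    MemLp (conjDilateHat k u v) 2 volume := by
  refine MemLp.const_mul ?_ _
  refine (memLp_waveletHat_comp_mul k hv).of_le ?_ (ae_of_all _ fun ξ => ?_)
  · exact ((Real.fourierIntegral_convergent_iff u).2
      ((integrable_waveletHat k).comp_mul_left' hv.ne')).aestronglyMeasurable
  · rw [Circle.norm_smul]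

/-- Substitute η = vξ in the inversion integral and write v^(-1/2) = √v · v⁻¹. As `waveletHat` is
real, conjugation only reverses the phase. -/
theorem dilate_fourierInv_waveletHat (k : ℕ) (u t : ℝ) {v : ℝ} (hv : 0 < v) :
    dilate v (𝓕⁻ (waveletHat k)) (u - t) = (starRingEnd ℂ) (𝓕⁻ (conjDilateHat k u v) t) := by
  have h1 := Measure.integral_comp_mul_left (fun η : ℝ =>
    Complex.exp (((2 * Real.pi * inner ℝ η ((u - t) / v) : ℝ) : ℂ) * Complex.I) •
      waveletHat k η) v
  rw [abs_of_pos (inv_pos.2 hv)] at h1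
  have h2 : (((√v)⁻¹ : ℝ) : ℂ) = ((√v : ℝ) : ℂ) * ((v⁻¹ : ℝ) : ℂ) := by
    rw [← Complex.ofReal_mul]
    congr 1
    nth_rw 3 [← Real.mul_self_sqrt hv.le]
    have : √v ≠ 0 := (Real.sqrt_pos.2 hv).ne'
    field_simp
  rw [dilate, Real.fourierInv_eq', Real.fourierInv_eq', ← integral_conj, h2, mul_assoc,
    ← Complex.real_smul (x := v⁻¹), ← h1, ← integral_const_mul]
  refine integral_congr_ae (ae_of_all _ fun ξ => ?_)
  simp only [conjDilateHat, smul_eq_mul, map_mul, conj_waveletHat, Complex.conj_ofReal,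
    Circle.smul_def, Real.fourierChar_apply, ← Complex.exp_conj, Complex.conj_I]
  have h3 : Complex.exp (((2 * Real.pi * inner ℝ (v * ξ) ((u - t) / v) : ℝ) : ℂ) * Complex.I) =
      Complex.exp (((2 * Real.pi * inner ℝ ξ t : ℝ) : ℂ) * -Complex.I) *
        Complex.exp (((2 * Real.pi * -inner ℝ ξ u : ℝ) : ℂ) * -Complex.I) := by
    rw [← Complex.exp_add]
    congr 1
    simp only [RCLike.inner_apply, conj_trivial]
    have : (v : ℂ) ≠ 0 := by simpa using hv.ne'
    push_cast
    field_simp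
    ring
  rw [h3]
  ring

/-- The convolution at (u, v) is the inner product of f with `t ↦ conj (ψ_v (u - t))`; Parseval
moves it to the frequency side. -/
theorem waveletTransform_eq_bargmannInv (k : ℕ) (f : Lp ℂ 2 (volume : Measure ℝ)) (u : ℝ) {v : ℝ}
    (hv : 0 < v) :
    waveletTransform k f (u, v) = bargmannInv k (Lp.fourierTransformₗᵢ ℝ ℂ f) (u, v) := by
  have hn1 := integrable_conjDilateHat k u hv
  have hn2 := memLp_conjDilateHat k u hv
  have h2 : waveletTransform k f (u, v) =
      inner ℂ ((Lp.fourierTransformₗᵢ ℝ ℂ).symm (hn2.toLp _)) f := by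
    rw [L2.inner_def, waveletTransform, convolution]
    refine integral_congr_ae ?_
    filter_upwards [coeFn_fourier_symm_toLp hn1 hn2,
      (quasiMeasurePreserving_sub_div u hv).ae (coeFn_wavelet k)] with t ht ht'
    rw [ht, RCLike.inner_apply, ← dilate_fourierInv_waveletHat k u t hv,
      ContinuousLinearMap.mul_apply']
    simp only [dilate, ht']
  have h3 : inner ℂ ((Lp.fourierTransformₗᵢ ℝ ℂ).symm (hn2.toLp _)) f =
      inner ℂ (hn2.toLp _) (Lp.fourierTransformₗᵢ ℝ ℂ f) := by
    rw [← LinearIsometryEquiv.inner_map_map (Lp.fourierTransformₗᵢ ℝ ℂ),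
      LinearIsometryEquiv.apply_symm_apply]
  rw [h2, h3, bargmannInv_eq_fourierInv k _ u hv, L2.inner_def, Real.fourierInv_eq']
  refine integral_congr_ae ?_
  filter_upwards [hn2.coeFn_toLp] with ξ hξ
  rw [hξ, RCLike.inner_apply]
  simp only [conjDilateHat, horizontalHat, smul_eq_mul, map_mul, conj_waveletHat,
    Complex.conj_ofReal, Circle.smul_def, Real.fourierChar_apply, ← Complex.exp_conj,
    Complex.conj_I]
  push_cast
  ring_nf

/-- Restricting the Fourier transform of f to ℝ_+ gives one inclusion. Extending g by zero and
inverting the Fourier transform gives a Hardy function for the other. -/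
theorem waveletSubspace_eq_range (k : ℕ) :
    waveletSubspace k = LinearMap.range (bargmannInvₗᵢ k).toLinearMap := by
  ext F
  constructor
  · rintro ⟨f, -, hF⟩
    have hg : MemLp (Lp.fourierTransformₗᵢ ℝ ℂ f) 2 (volume.restrict (Ioi 0)) :=
      (Lp.memLp _).restrict _
    refine ⟨hg.toLp _, ?_⟩
    refine Lp.ext ?_
    refine (coeFn_bargmannInvₗᵢ k _).trans (Filter.EventuallyEq.trans ?_ hF.symm)
    rw [bargmannInv_congr_ae k hg.coeFn_toLp]
    exact ae_nu_of_forall_pos fun u v hv => (waveletTransform_eq_bargmannInv k f u hv).symm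
  · rintro ⟨g, rfl⟩
    have hg : MemLp ((Ioi (0 : ℝ)).indicator g) 2 volume :=
      (memLp_indicator_iff_restrict measurableSet_Ioi).2 (Lp.memLp g)
    refine ⟨(Lp.fourierTransformₗᵢ ℝ ℂ).symm (hg.toLp _), ?_, ?_⟩
    · change ∀ᵐ ξ, ξ < 0 → Lp.fourierTransformₗᵢ ℝ ℂ
        ((Lp.fourierTransformₗᵢ ℝ ℂ).symm (hg.toLp _)) ξ = 0
      rw [LinearIsometryEquiv.apply_symm_apply]
      filter_upwards [hg.coeFn_toLp] with ξ hξ hneg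
      rw [hξ, indicator_of_notMem (by simpa using hneg.le)]
    · refine (coeFn_bargmannInvₗᵢ k g).trans (ae_nu_of_forall_pos fun u v hv => ?_)
      rw [waveletTransform_eq_bargmannInv k _ u hv, LinearIsometryEquiv.apply_symm_apply]
      refine congrFun (bargmannInv_congr_ae k ?_) _
      filter_upwards [ae_restrict_of_ae hg.coeFn_toLp, ae_restrict_mem measurableSet_Ioi]
        with ξ h1 h2
      rw [h1, indicator_of_mem h2]

/-! ### The Bargmann-type transform -/

theorem isHorizontalFourier_bargmannInvₗᵢ (k : ℕ) (f : L2Plus) :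
    IsHorizontalFourier (bargmannInvₗᵢ k f)
      ((memLp_horizontalHat k (Lp.stronglyMeasurable f) (Lp.memLp f)).toLp _) := by
  -- The slices are controlled for `nuPlus`-almost every v, while the definition asks for
  -- Lebesgue-almost every v > 0.
  refine absolutelyContinuous_nuPlus.ae_le ?_
  filter_upwards [ae_ae_of_ae_nu (coeFn_bargmannInvₗᵢ k f),
    ae_ae_of_ae_nu (memLp_horizontalHat k (Lp.stronglyMeasurable f) (Lp.memLp f)).coeFn_toLp,
    ae_bargmannInv_eq_fourier_symm k (Lp.stronglyMeasurable f) (Lp.memLp f)] with v h1 h2 ⟨h3, h4⟩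
  have h5 : (fun u => bargmannInvₗᵢ k f (u, v)) =ᵐ[volume]
      (Lp.fourierTransformₗᵢ ℝ ℂ).symm (h3.toLp _) := Filter.EventuallyEq.trans h1 h4.symm
  have h6 : MemLp (fun u => bargmannInvₗᵢ k f (u, v)) 2 volume := (memLp_congr_ae h5).2 (Lp.memLp _)
  refine ⟨h6, ?_⟩
  have h7 : h6.toLp _ = (Lp.fourierTransformₗᵢ ℝ ℂ).symm (h3.toLp _) :=
    Lp.ext (h6.coeFn_toLp.trans h5)
  rw [h7, LinearIsometryEquiv.apply_symm_apply]
  exact h3.coeFn_toLp.trans (Filter.EventuallyEq.symm h2)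

/-- `U₂` rescales every profile to the same function: the result is `f(x) ℓ_k(t)`, and pairing with
the unit vector `ℓ_k` returns f(x). -/
theorem opQStar_opU2_horizontalHat (k : ℕ) (f : ℝ → ℂ) {H : ℝ × ℝ → ℂ}
    (hH : H =ᵐ[nu] horizontalHat k f) :
    f =ᵐ[volume.restrict (Ioi 0)] opQStar k (opU2 H) := by
  have h := Measure.ae_ae_of_ae_prod hH
  filter_upwards [ae_restrict_of_ae h, ae_restrict_mem measurableSet_Ioi] with x hx (hpos : 0 < x)
  have h2 : 0 < 2 * x := by positivity
  have h3 := (quasiMeasurePreserving_div_Ioi h2).ae (absolutelyContinuous_nuPlus.ae_le hx)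
  have h4 : opQStar k (opU2 H) x =
      ∫ t in Ioi (0 : ℝ), f x * ((laguerreFun k t ^ 2 : ℝ) : ℂ) := by
    refine integral_congr_ae ?_
    filter_upwards [h3, ae_restrict_mem measurableSet_Ioi] with t ht (htpos : 0 < t)
    simp only [opU2, abs_of_pos hpos, ht]
    rw [horizontalHat_of_pos k f hpos (by positivity)]
    have h5 : 2 * x * (t / (2 * x)) = t := by field_simp
    have h6 : √(2 * x) / t * (√2 * (t / (2 * x)) * √x) = 1 := by
      rw [Real.sqrt_mul zero_le_two]
      have h8 := Real.mul_self_sqrt hpos.le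
      have h9 := Real.mul_self_sqrt (zero_le_two (α := ℝ))
      field_simp
      rw [Real.sq_sqrt hpos.le, Real.sq_sqrt zero_le_two]
    rw [h5]
    calc _ = ((√(2 * x) / t * (√2 * (t / (2 * x)) * √x) : ℝ) : ℂ) * f x *
          ((laguerreFun k t ^ 2 : ℝ) : ℂ) := by push_cast; ring
      _ = _ := by rw [h6]; push_cast; ring
  rw [h4, integral_const_mul, integral_complex_ofReal, integral_laguerreFun_sq]
  simp

/-- The Bargmann-type transform `R_k` of `A^{(k)}` onto `L₂(ℝ_+)`. -/
noncomputable def bargmann (k : ℕ) : waveletSubspace k ≃ₗᵢ[ℂ] L2Plus :=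
  ((bargmannInvₗᵢ k).equivRange.trans
    (LinearIsometryEquiv.ofEq _ _ (waveletSubspace_eq_range k).symm)).symm

theorem bargmann_symm_apply (k : ℕ) (f : L2Plus) :
    ((bargmann k).symm f : L2G) = bargmannInvₗᵢ k f := rfl

theorem bargmannInvₗᵢ_bargmann (k : ℕ) (F : waveletSubspace k) :
    bargmannInvₗᵢ k (bargmann k F) = F := by
  rw [← bargmann_symm_apply, LinearIsometryEquiv.symm_apply_apply]

theorem coeFn_waveletSubspace (k : ℕ) (F : waveletSubspace k) :
    (F : L2G) =ᵐ[nu] bargmannInv k (bargmann k F) := by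
  have h := coeFn_bargmannInvₗᵢ k (bargmann k F)
  rwa [bargmannInvₗᵢ_bargmann] at h

theorem isBargmann_bargmann (k : ℕ) : IsBargmann k (bargmann k) := by
  refine ⟨fun F => ⟨_, bargmannInvₗᵢ_bargmann k F ▸
    isHorizontalFourier_bargmannInvₗᵢ k (bargmann k F), ?_⟩, fun f => coeFn_bargmannInvₗᵢ k f⟩
  exact opQStar_opU2_horizontalHat k _ (MemLp.coeFn_toLp _)

/-- Completeness is transported from `L₂(ℝ_+)` along the isometry. -/
theorem hasOrthogonalProjection_waveletSubspace (k : ℕ) :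
    (waveletSubspace k).HasOrthogonalProjection := by
  have : CompleteSpace (waveletSubspace k) :=
    (completeSpace_congr (e := (bargmann k).toEquiv)
      (bargmann k).isometry.isUniformEmbedding).2 inferInstance
  infer_instance

/-! ### The function `γ` -/

theorem lintegral_enorm_sq_mul_laguerreFun_sq (k : ℕ) (a : ℝ → ℂ) (ξ : ℝ) :
    ∫⁻ v in Ioi (0 : ℝ), ‖a (v / (2 * ξ)) * ((laguerreFun k v : ℝ) : ℂ)‖ₑ ^ 2 =
      ∫⁻ v in Ioi (0 : ℝ), ‖a (v / (2 * ξ))‖ₑ ^ 2 * ENNReal.ofReal (laguerreFun k v ^ 2) := by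
  refine lintegral_congr fun v => ?_
  rw [enorm_mul, mul_pow, ← ofReal_norm (((laguerreFun k v : ℝ) : ℂ)), Complex.norm_real,
    ← ENNReal.ofReal_pow (norm_nonneg _), Real.norm_eq_abs, sq_abs]

theorem memLp_laguerreFun (k : ℕ) :
    MemLp (fun v => ((laguerreFun k v : ℝ) : ℂ)) 2 (volume.restrict (Ioi 0)) := by
  have hl := continuous_laguerreFun k
  rw [memLp_two_iff_lintegral
    (by fun_prop : Continuous fun v => ((laguerreFun k v : ℝ) : ℂ)).aestronglyMeasurable]
  have := lintegral_enorm_sq_mul_laguerreFun_sq k (fun _ => 1) 1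
  simp only [one_mul, enorm_one, one_pow, lintegral_laguerreFun_sq] at this
  rw [this]
  exact ENNReal.one_lt_top

theorem eLpNorm_laguerreFun (k : ℕ) :
    eLpNorm (fun v => ((laguerreFun k v : ℝ) : ℂ)) 2 (volume.restrict (Ioi 0)) = 1 := by
  have := lintegral_enorm_sq_mul_laguerreFun_sq k (fun _ => 1) 1
  simp only [one_mul, enorm_one, one_pow, lintegral_laguerreFun_sq] at this
  rw [eLpNorm_two_eq, this, ENNReal.one_rpow]

section Symbol

variable {a : ℝ → ℂ}

theorem aestronglyMeasurable_comp_div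
    (ha : AEStronglyMeasurable a ((volume : Measure ℝ).restrict (Ioi 0))) {ξ : ℝ} (hξ : 0 < ξ) :
    AEStronglyMeasurable (fun v => a (v / (2 * ξ))) (volume.restrict (Ioi 0)) :=
  ha.comp_quasiMeasurePreserving (quasiMeasurePreserving_div_Ioi (by positivity : 0 < 2 * ξ))

theorem memLp_symbol_mul_laguerreFun (k : ℕ)
    (ha : AEStronglyMeasurable a ((volume : Measure ℝ).restrict (Ioi 0))) {ξ : ℝ} (hξ : 0 < ξ)
    (h : ∫⁻ v in Ioi (0 : ℝ), ‖a (v / (2 * ξ))‖ₑ ^ 2 * ENNReal.ofReal (laguerreFun k v ^ 2) < ∞) :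
    MemLp (fun v => a (v / (2 * ξ)) * ((laguerreFun k v : ℝ) : ℂ)) 2
      (volume.restrict (Ioi 0)) := by
  rw [memLp_two_iff_lintegral, lintegral_enorm_sq_mul_laguerreFun_sq]
  · exact h
  · exact (aestronglyMeasurable_comp_div ha hξ).mul (memLp_laguerreFun k).1

theorem integrableOn_symbol_mul_laguerreFun_sq (k : ℕ)
    (ha : AEStronglyMeasurable a ((volume : Measure ℝ).restrict (Ioi 0))) {ξ : ℝ} (hξ : 0 < ξ)
    (h : ∫⁻ v in Ioi (0 : ℝ), ‖a (v / (2 * ξ))‖ₑ ^ 2 * ENNReal.ofReal (laguerreFun k v ^ 2) < ∞) :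
    IntegrableOn (fun v => a (v / (2 * ξ)) * ((laguerreFun k v ^ 2 : ℝ) : ℂ)) (Ioi 0) := by
  refine ((memLp_symbol_mul_laguerreFun k ha hξ h).integrable_mul (memLp_laguerreFun k)).congr ?_
  refine ae_of_all _ fun v => ?_
  simp only [Pi.mul_apply]
  push_cast
  ring

/-- Cauchy–Schwarz for `(a ℓ_k) · ℓ_k` with `ℓ_k` of norm one. If the integral defining γ diverges,
its default value 0 still satisfies the bound. -/
theorem enorm_gammaFun_sq_le (k : ℕ)
    (ha : AEStronglyMeasurable a ((volume : Measure ℝ).restrict (Ioi 0))) {ξ : ℝ} (hξ : 0 < ξ) :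
    ‖gammaFun k a ξ‖ₑ ^ 2 ≤
      ∫⁻ v in Ioi (0 : ℝ), ‖a (v / (2 * ξ))‖ₑ ^ 2 * ENNReal.ofReal (laguerreFun k v ^ 2) := by
  set φ : ℝ → ℂ := fun v => a (v / (2 * ξ)) * ((laguerreFun k v : ℝ) : ℂ) with hφ
  set ψ : ℝ → ℂ := fun v => ((laguerreFun k v : ℝ) : ℂ) with hψ
  have hm : AEStronglyMeasurable φ (volume.restrict (Ioi 0)) :=
    (aestronglyMeasurable_comp_div ha hξ).mul (memLp_laguerreFun k).1
  have h1 : eLpNorm (φ • ψ) 1 (volume.restrict (Ioi 0)) ≤ eLpNorm φ 2 (volume.restrict (Ioi 0)) *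
      eLpNorm ψ 2 (volume.restrict (Ioi 0)) :=
    eLpNorm_smul_le_mul_eLpNorm (memLp_laguerreFun k).1 hm
  rw [eLpNorm_laguerreFun, mul_one, eLpNorm_one_eq_lintegral_enorm] at h1
  rw [← lintegral_enorm_sq_mul_laguerreFun_sq, lintegral_enorm_sq_eq_eLpNorm_sq]
  refine pow_le_pow_left' (le_trans ?_ h1) 2
  refine (enorm_integral_le_lintegral_enorm _).trans_eq (lintegral_congr fun v => ?_)
  congr 1
  simp only [hφ, hψ, Pi.smul_apply', smul_eq_mul]
  push_cast
  ring

theorem aestronglyMeasurable_gammaFun (k : ℕ)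
    (ha : AEStronglyMeasurable a ((volume : Measure ℝ).restrict (Ioi 0))) :
    AEStronglyMeasurable (gammaFun k a) (volume.restrict (Ioi 0)) := by
  have hl := continuous_laguerreFun k
  have hm : StronglyMeasurable fun p : ℝ × ℝ =>
      ha.mk a (p.2 / (2 * p.1)) * ((laguerreFun k p.2 ^ 2 : ℝ) : ℂ) := by
    refine (ha.stronglyMeasurable_mk.comp_measurable (by fun_prop)).mul ?_
    exact (by fun_prop : Continuous fun p : ℝ × ℝ =>
      ((laguerreFun k p.2 ^ 2 : ℝ) : ℂ)).stronglyMeasurable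
  refine ⟨gammaFun k (ha.mk a), hm.integral_prod_right, ?_⟩
  filter_upwards [ae_restrict_mem measurableSet_Ioi] with ξ (hξ : 0 < ξ)
  refine integral_congr_ae ?_
  filter_upwards [(quasiMeasurePreserving_div_Ioi (by positivity : 0 < 2 * ξ)).ae ha.ae_eq_mk]
    with v hv
  rw [hv]

theorem ae_norm_comp_div_le (ha : MemLp a ∞ ((volume : Measure ℝ).restrict (Ioi 0))) {ξ : ℝ}
    (hξ : 0 < ξ) : ∀ᵐ v ∂(volume : Measure ℝ).restrict (Ioi 0),
      ‖a (v / (2 * ξ))‖ ≤ (eLpNorm a ∞ (volume.restrict (Ioi 0))).toReal := by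
  refine (quasiMeasurePreserving_div_Ioi (by positivity : 0 < 2 * ξ)).ae
    (p := fun v => ‖a v‖ ≤ (eLpNorm a ∞ (volume.restrict (Ioi 0))).toReal) ?_
  have h := ae_le_eLpNormEssSup (f := a) (μ := (volume : Measure ℝ).restrict (Ioi 0))
  filter_upwards [h] with v hv
  rw [← toReal_enorm]
  exact ENNReal.toReal_mono ha.2.ne (by rwa [eLpNorm_exponent_top])

theorem integrableOn_bounded_mul_laguerreFun_sq (k : ℕ)
    (ha : MemLp a ∞ ((volume : Measure ℝ).restrict (Ioi 0))) {ξ : ℝ} (hξ : 0 < ξ) :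
    IntegrableOn (fun v => a (v / (2 * ξ)) * ((laguerreFun k v ^ 2 : ℝ) : ℂ)) (Ioi 0) :=
  (integrableOn_laguerreFun_sq k).ofReal.bdd_mul (aestronglyMeasurable_comp_div ha.1 hξ)
    (ae_norm_comp_div_le ha hξ)

theorem norm_gammaFun_le (k : ℕ)
    (ha : MemLp a ∞ ((volume : Measure ℝ).restrict (Ioi 0))) {ξ : ℝ} (hξ : 0 < ξ) :
    ‖gammaFun k a ξ‖ ≤ (eLpNorm a ∞ (volume.restrict (Ioi 0))).toReal := by
  set C := (eLpNorm a ∞ (volume.restrict (Ioi 0))).toReal with hC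
  have h := norm_integral_le_of_norm_le (μ := volume.restrict (Ioi 0))
    (f := fun v => a (v / (2 * ξ)) * ((laguerreFun k v ^ 2 : ℝ) : ℂ))
    ((integrableOn_laguerreFun_sq k).const_mul C) (by
      filter_upwards [ae_norm_comp_div_le ha hξ] with v hv
      rw [norm_mul, Complex.norm_real, Real.norm_of_nonneg (sq_nonneg _)]
      gcongr)
  rwa [integral_const_mul, integral_laguerreFun_sq, mul_one] at h

end Symbol

/-! ### The action of the Calderón–Toeplitz operators -/

section Symbol

variable {a : ℝ → ℂ}

theorem enorm_symbol_mul_sq (g : ℝ × ℝ → ℂ) :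
    (fun ζ : ℝ × ℝ => ‖a ζ.2 * g ζ‖ₑ ^ 2) =
      fun ζ : ℝ × ℝ => (fun v => ‖a v‖ₑ ^ 2) ζ.2 * ‖g ζ‖ₑ ^ 2 := by
  ext ζ
  rw [enorm_mul, mul_pow]

theorem memLp_symbol_mul_bargmannInv_iff (k : ℕ)
    (ha : AEStronglyMeasurable a ((volume : Measure ℝ).restrict (Ioi 0))) {f : ℝ → ℂ}
    (hf : StronglyMeasurable f) (hf2 : MemLp f 2 (volume.restrict (Ioi 0))) :
    MemLp (fun ζ : ℝ × ℝ => a ζ.2 * bargmannInv k f ζ) 2 nu ↔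
      ∫⁻ ξ in Ioi (0 : ℝ), (∫⁻ v in Ioi (0 : ℝ),
        ‖a (v / (2 * ξ))‖ₑ ^ 2 * ENNReal.ofReal (laguerreFun k v ^ 2)) * ‖f ξ‖ₑ ^ 2 < ∞ := by
  have hm : AEStronglyMeasurable (fun ζ : ℝ × ℝ => a ζ.2 * bargmannInv k f ζ) nu :=
    (aestronglyMeasurable_comp_snd_nu ha).mul (stronglyMeasurable_bargmannInv k hf).aestronglyMeasurable
  rw [memLp_two_iff_lintegral hm, enorm_symbol_mul_sq,
    lintegral_bargmannInv k hf hf2 (ha.enorm.pow_const 2)]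

theorem memLp_symbol_mul_horizontalHat_iff (k : ℕ)
    (ha : AEStronglyMeasurable a ((volume : Measure ℝ).restrict (Ioi 0))) {f : ℝ → ℂ}
    (hf : StronglyMeasurable f) :
    MemLp (fun ζ : ℝ × ℝ => a ζ.2 * horizontalHat k f ζ) 2 nu ↔
      ∫⁻ ξ in Ioi (0 : ℝ), (∫⁻ v in Ioi (0 : ℝ),
        ‖a (v / (2 * ξ))‖ₑ ^ 2 * ENNReal.ofReal (laguerreFun k v ^ 2)) * ‖f ξ‖ₑ ^ 2 < ∞ := by
  have hm : AEStronglyMeasurable (fun ζ : ℝ × ℝ => a ζ.2 * horizontalHat k f ζ) nu :=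
    (aestronglyMeasurable_comp_snd_nu ha).mul (stronglyMeasurable_horizontalHat k hf).aestronglyMeasurable
  rw [memLp_two_iff_lintegral hm, enorm_symbol_mul_sq,
    lintegral_horizontalHat k hf (ha.enorm.pow_const 2)]

theorem ae_integral_bargmannInv_mul_conj (k : ℕ) (f g : L2Plus) :
    ∀ᵐ v ∂nuPlus,
      ∫ u, bargmannInv k f (u, v) * (starRingEnd ℂ) (bargmannInv k g (u, v)) =
        ∫ ξ, horizontalHat k f (ξ, v) * (starRingEnd ℂ) (horizontalHat k g (ξ, v)) := by
  filter_upwards [ae_bargmannInv_eq_fourier_symm k (Lp.stronglyMeasurable f) (Lp.memLp f),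
    ae_bargmannInv_eq_fourier_symm k (Lp.stronglyMeasurable g) (Lp.memLp g)]
    with v ⟨hf, hf'⟩ ⟨hg, hg'⟩
  have h := LinearIsometryEquiv.inner_map_map (Lp.fourierTransformₗᵢ ℝ ℂ).symm
    (hg.toLp _) (hf.toLp _)
  rw [L2.inner_def, L2.inner_def] at h
  refine Eq.trans ?_ (h.trans ?_)
  · refine integral_congr_ae ?_
    filter_upwards [hf', hg'] with u h1 h2
    rw [h1, h2, RCLike.inner_apply]
  · refine integral_congr_ae ?_
    filter_upwards [hf.coeFn_toLp, hg.coeFn_toLp] with u h1 h2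
    rw [h1, h2, RCLike.inner_apply]

/-- The fibrewise compression of a to the profile over ξ, computed by y = 2ξv. No convergence is
needed: the rules for scaling and constant factors also respect the default value of the integral.
-/
theorem integral_nuPlus_symbol_horizontalHat (k : ℕ) (f g : ℝ → ℂ) {ξ : ℝ} (hξ : 0 < ξ) :
    ∫ v, a v * (horizontalHat k f (ξ, v) * (starRingEnd ℂ) (horizontalHat k g (ξ, v))) ∂nuPlus =
      gammaFun k a ξ * f ξ * (starRingEnd ℂ) (g ξ) := by
  have h2 : 0 < 2 * ξ := by positivity
  have h2' : (2 * (ξ : ℂ)) ≠ 0 := by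
    have : (ξ : ℂ) ≠ 0 := by exact_mod_cast hξ.ne'
    simpa using this
  have h := integral_comp_mul_left_Ioi
    (fun y => a (y / (2 * ξ)) * ((laguerreFun k y ^ 2 : ℝ) : ℂ)) 0 h2
  rw [mul_zero] at h
  have h3 : gammaFun k a ξ = ((2 * ξ : ℝ) : ℂ) *
      ∫ v in Ioi (0 : ℝ), a (2 * ξ * v / (2 * ξ)) * ((laguerreFun k (2 * ξ * v) ^ 2 : ℝ) : ℂ) := by
    rw [h, Complex.real_smul, gammaFun]
    push_cast
    rw [← mul_assoc, mul_inv_cancel₀ h2', one_mul]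
  rw [h3, integral_nuPlus, ← integral_const_mul, ← integral_mul_const, ← integral_mul_const]
  refine setIntegral_congr_fun measurableSet_Ioi fun v (hv : 0 < v) => ?_
  have h4 : 2 * ξ * v / (2 * ξ) = v := by field_simp
  have h5 : (v ^ 2)⁻¹ * ((√2 * v * √ξ * laguerreFun k (2 * ξ * v)) *
      (√2 * v * √ξ * laguerreFun k (2 * ξ * v))) = 2 * ξ * laguerreFun k (2 * ξ * v) ^ 2 := by
    have e1 := Real.mul_self_sqrt hξ.le
    have e2 := Real.mul_self_sqrt (zero_le_two (α := ℝ))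
    calc _ = (v ^ 2)⁻¹ * v ^ 2 * ((√2 * √2) * (√ξ * √ξ)) * laguerreFun k (2 * ξ * v) ^ 2 := by ring
      _ = _ := by rw [e1, e2, inv_mul_cancel₀ (by positivity), one_mul]
  simp only [h4, horizontalHat_of_pos k _ hξ hv, map_mul, Complex.conj_ofReal]
  calc _ = (((v ^ 2)⁻¹ * ((√2 * v * √ξ * laguerreFun k (2 * ξ * v)) *
          (√2 * v * √ξ * laguerreFun k (2 * ξ * v))) : ℝ) : ℂ) * a v * f ξ *
          (starRingEnd ℂ) (g ξ) := by push_cast; ring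
    _ = _ := by rw [h5]; push_cast; ring

/-- Fubini with v outside allows Parseval on each horizontal line, where a(v) is a constant. Fubini
with ξ outside then produces γ(ξ) on each fibre. -/
theorem integral_symbol_bargmannInv_mul_conj (k : ℕ)
    (ha : AEStronglyMeasurable a ((volume : Measure ℝ).restrict (Ioi 0))) (f g : L2Plus)
    (h : MemLp (fun ζ : ℝ × ℝ => a ζ.2 * bargmannInv k f ζ) 2 nu) :
    ∫ ζ, a ζ.2 * bargmannInv k f ζ * (starRingEnd ℂ) (bargmannInv k g ζ) ∂nu =
      ∫ ξ in Ioi (0 : ℝ), gammaFun k a ξ * f ξ * (starRingEnd ℂ) (g ξ) := by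
  have hf := Lp.stronglyMeasurable f
  have hg := Lp.stronglyMeasurable g
  -- Both membership conditions are equivalent to finiteness of the same weighted integral.
  have h' : MemLp (fun ζ : ℝ × ℝ => a ζ.2 * horizontalHat k f ζ) 2 nu :=
    (memLp_symbol_mul_horizontalHat_iff k ha hf).2
      ((memLp_symbol_mul_bargmannInv_iff k ha hf (Lp.memLp f)).1 h)
  have i1 : Integrable (fun ζ : ℝ × ℝ =>
      a ζ.2 * (bargmannInv k f ζ * (starRingEnd ℂ) (bargmannInv k g ζ))) nu := by
    simpa only [Pi.mul_def, mul_assoc, Pi.star_apply, RCLike.star_def] using!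
      h.integrable_mul (memLp_bargmannInv k hg (Lp.memLp g)).star
  have i2 : Integrable (fun ζ : ℝ × ℝ =>
      a ζ.2 * (horizontalHat k f ζ * (starRingEnd ℂ) (horizontalHat k g ζ))) nu := by
    simpa only [Pi.mul_def, mul_assoc, Pi.star_apply, RCLike.star_def] using!
      h'.integrable_mul (memLp_horizontalHat k hg (Lp.memLp g)).star
  calc ∫ ζ, a ζ.2 * bargmannInv k f ζ * (starRingEnd ℂ) (bargmannInv k g ζ) ∂nu
      = ∫ v, a v * (∫ u, bargmannInv k f (u, v) *
          (starRingEnd ℂ) (bargmannInv k g (u, v))) ∂nuPlus := by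
        simp_rw [mul_assoc, ← integral_const_mul]
        exact integral_prod_symm _ i1
    _ = ∫ v, a v * (∫ ξ, horizontalHat k f (ξ, v) *
          (starRingEnd ℂ) (horizontalHat k g (ξ, v))) ∂nuPlus := by
        refine integral_congr_ae ?_
        filter_upwards [ae_integral_bargmannInv_mul_conj k f g] with v hv
        rw [hv]
    _ = ∫ ζ, a ζ.2 * (horizontalHat k f ζ * (starRingEnd ℂ) (horizontalHat k g ζ)) ∂nu := by
        simp_rw [← integral_const_mul]
        exact (integral_prod_symm _ i2).symm
    _ = ∫ ξ, ∫ v, a v * (horizontalHat k f (ξ, v) *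
          (starRingEnd ℂ) (horizontalHat k g (ξ, v))) ∂nuPlus := integral_prod _ i2
    _ = ∫ ξ in Ioi (0 : ℝ), gammaFun k a ξ * f ξ * (starRingEnd ℂ) (g ξ) := by
        rw [← integral_indicator measurableSet_Ioi]
        refine integral_congr_ae (ae_of_all _ fun ξ => ?_)
        by_cases hξ : 0 < ξ
        · simp only [indicator_of_mem (show ξ ∈ Ioi (0 : ℝ) from hξ),
            integral_nuPlus_symbol_horizontalHat k f g hξ]
        · simp only [indicator_of_notMem (show ξ ∉ Ioi (0 : ℝ) from hξ)]
          refine integral_eq_zero_of_ae ?_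
          filter_upwards [ae_nuPlus_pos] with v hv
          simp [horizontalHat_of_nonpos k f (not_lt.1 hξ) hv]

/-- A finite integral has an almost everywhere finite integrand, and ∞ times a nonzero factor is ∞.
The inner integral is measured through a measurable representative of a. -/
theorem ae_finite_of_lintegral_finite (k : ℕ)
    (ha : AEStronglyMeasurable a ((volume : Measure ℝ).restrict (Ioi 0))) {f : ℝ → ℂ}
    (hf : StronglyMeasurable f)
    (h : ∫⁻ ξ in Ioi (0 : ℝ), (∫⁻ v in Ioi (0 : ℝ),
        ‖a (v / (2 * ξ))‖ₑ ^ 2 * ENNReal.ofReal (laguerreFun k v ^ 2)) * ‖f ξ‖ₑ ^ 2 < ∞) :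
    ∀ᵐ ξ ∂(volume : Measure ℝ).restrict (Ioi 0), f ξ ≠ 0 → ∫⁻ v in Ioi (0 : ℝ),
        ‖a (v / (2 * ξ))‖ₑ ^ 2 * ENNReal.ofReal (laguerreFun k v ^ 2) < ∞ := by
  have hl := continuous_laguerreFun k
  set G : (ℝ → ℂ) → ℝ → ℝ≥0∞ := fun b ξ => ∫⁻ v in Ioi (0 : ℝ),
        ‖b (v / (2 * ξ))‖ₑ ^ 2 * ENNReal.ofReal (laguerreFun k v ^ 2) with hG
  have hm : Measurable (G (ha.mk a)) := by
    have h1 : Measurable fun p : ℝ × ℝ => p.2 / (2 * p.1) := by fun_prop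
    have h2 : Measurable fun p : ℝ × ℝ => ENNReal.ofReal (laguerreFun k p.2 ^ 2) := by fun_prop
    have h3 : Measurable fun p : ℝ × ℝ => ‖ha.mk a (p.2 / (2 * p.1))‖ₑ ^ 2 :=
      (ha.stronglyMeasurable_mk.enorm.comp h1).pow_const 2
    exact (h3.mul h2).lintegral_prod_right'
  have he : G a =ᵐ[volume.restrict (Ioi 0)] G (ha.mk a) := by
    filter_upwards [ae_restrict_mem measurableSet_Ioi] with ξ (hξ : 0 < ξ)
    refine lintegral_congr_ae ?_
    filter_upwards [(quasiMeasurePreserving_div_Ioi (by positivity : 0 < 2 * ξ)).ae ha.ae_eq_mk]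
      with v hv
    rw [hv]
  have hm2 : AEMeasurable (G a) (volume.restrict (Ioi 0)) := ⟨_, hm, he⟩
  have h2 := ae_lt_top' (hm2.mul (hf.enorm.pow_const 2).aemeasurable) h.ne
  filter_upwards [h2] with ξ hξ hne
  by_contra hcon
  rw [not_lt, top_le_iff] at hcon
  have h3 : G a ξ = ∞ := hcon
  simp [h3, ENNReal.top_mul, hne] at hξ

theorem memLp_gammaFun_mul (k : ℕ)
    (ha : AEStronglyMeasurable a ((volume : Measure ℝ).restrict (Ioi 0))) {f : ℝ → ℂ}
    (hf : StronglyMeasurable f)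
    (h : ∫⁻ ξ in Ioi (0 : ℝ), (∫⁻ v in Ioi (0 : ℝ),
        ‖a (v / (2 * ξ))‖ₑ ^ 2 * ENNReal.ofReal (laguerreFun k v ^ 2)) * ‖f ξ‖ₑ ^ 2 < ∞) :
    MemLp (fun ξ => gammaFun k a ξ * f ξ) 2 (volume.restrict (Ioi 0)) := by
  have hm : AEStronglyMeasurable (fun ξ => gammaFun k a ξ * f ξ) (volume.restrict (Ioi 0)) :=
    (aestronglyMeasurable_gammaFun k ha).mul hf.aestronglyMeasurable
  rw [memLp_two_iff_lintegral hm]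
  refine lt_of_le_of_lt (setLIntegral_mono' measurableSet_Ioi fun ξ (hξ : 0 < ξ) => ?_) h
  rw [enorm_mul, mul_pow]
  gcongr
  exact enorm_gammaFun_sq_le k ha hξ

theorem mem_toeplitz_domain_iff (k : ℕ) [(waveletSubspace k).HasOrthogonalProjection]
    (F : waveletSubspace k) :
    F ∈ (toeplitz k fun ζ => a ζ.2).domain ↔
      MemLp (fun ζ : ℝ × ℝ => a ζ.2 * bargmannInv k (bargmann k F) ζ) 2 nu := by
  change MemLp (fun ζ : ℝ × ℝ => a ζ.2 * (F : L2G) ζ) 2 nu ↔ _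
  refine memLp_congr_ae ?_
  filter_upwards [coeFn_waveletSubspace k F] with ζ h
  rw [h]

/-- Tested against g: since `R_k^* g` lies in `A^{(k)}`, the projection drops out of the inner
product and the form identity applies. -/
theorem bargmann_toeplitz (k : ℕ) [(waveletSubspace k).HasOrthogonalProjection]
    (ha : AEStronglyMeasurable a ((volume : Measure ℝ).restrict (Ioi 0)))
    (F : (toeplitz k fun ζ => a ζ.2).domain)
    (h : MemLp (fun ξ => gammaFun k a ξ * bargmann k F ξ) 2 (volume.restrict (Ioi 0))) :
    bargmann k ((toeplitz k fun ζ => a ζ.2) F) = h.toLp _ := by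
  refine ext_inner_left ℂ fun g => ?_
  have hF := (mem_toeplitz_domain_iff k (F : waveletSubspace k)).1 F.2
  have hF' : MemLp (fun ζ : ℝ × ℝ => a ζ.2 * ((F : waveletSubspace k) : L2G) ζ) 2 nu := F.2
  have e1 : inner ℂ g (bargmann k ((toeplitz k fun ζ => a ζ.2) F)) =
      inner ℂ ((bargmann k).symm g) ((toeplitz k fun ζ => a ζ.2) F) := by
    rw [← LinearIsometryEquiv.inner_map_map (bargmann k), LinearIsometryEquiv.apply_symm_apply]
  have e2 : inner ℂ ((bargmann k).symm g) ((toeplitz k fun ζ => a ζ.2) F) =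
      inner ℂ (bargmannInvₗᵢ k g) (hF'.toLp _) :=
    Submodule.inner_orthogonalProjectionOnto_eq_of_mem_left ((bargmann k).symm g) (hF'.toLp _)
  rw [e1, e2, L2.inner_def, L2.inner_def]
  refine Eq.trans ?_ ((integral_symbol_bargmannInv_mul_conj k ha (bargmann k F) g hF).trans ?_)
  · refine integral_congr_ae ?_
    filter_upwards [hF'.coeFn_toLp, coeFn_bargmannInvₗᵢ k g, coeFn_waveletSubspace k F]
      with ζ h1 h2 h3
    rw [h1, h2, h3, RCLike.inner_apply]
  · refine integral_congr_ae ?_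
    filter_upwards [h.coeFn_toLp] with ξ h1
    rw [h1, RCLike.inner_apply]

theorem lintegral_symbol_finite_of_bounded (k : ℕ)
    (ha : MemLp a ∞ ((volume : Measure ℝ).restrict (Ioi 0))) (f : L2Plus) :
    ∫⁻ ξ in Ioi (0 : ℝ), (∫⁻ v in Ioi (0 : ℝ),
        ‖a (v / (2 * ξ))‖ₑ ^ 2 * ENNReal.ofReal (laguerreFun k v ^ 2)) * ‖f ξ‖ₑ ^ 2 < ∞ := by
  rw [← memLp_symbol_mul_bargmannInv_iff k ha.1 (Lp.stronglyMeasurable f) (Lp.memLp f)]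
  have hb : MemLp (fun ζ : ℝ × ℝ => a ζ.2) ∞ nu := by
    refine memLp_top_of_bound (aestronglyMeasurable_comp_snd_nu ha.1)
      (eLpNorm a ∞ (volume.restrict (Ioi 0))).toReal ?_
    have h1 : ∀ᵐ v ∂nuPlus, ‖a v‖ ≤ (eLpNorm a ∞ (volume.restrict (Ioi 0))).toReal := by
      refine nuPlus_absolutelyContinuous.ae_le ?_
      -- At ξ = 1/2 the dilation v / (2ξ) is the identity.
      have h := ae_norm_comp_div_le ha (ξ := 1 / 2) (by norm_num)
      rw [show 2 * (1 / 2 : ℝ) = 1 by norm_num] at h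
      simp only [div_one] at h
      exact h
    exact Measure.quasiMeasurePreserving_snd.ae h1
  exact (memLp_bargmannInv_Lp k f).mul hb

end Symbol

end CalderonToeplitz

/-- Closedness of `A^{(k)}` appears as the existence of its orthogonal projection, equivalent to it
in a Hilbert space and needed for `toeplitz` to make sense. -/
theorem mainTheorem1 (k : ℕ) :
    ∃ _hP : (waveletSubspace k).HasOrthogonalProjection,
    ∃ R : waveletSubspace k ≃ₗᵢ[ℂ] L2Plus, IsBargmann k R ∧
      ∀ a : ℝ → ℂ, AEStronglyMeasurable a (volume.restrict (Ioi 0)) →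
        -- bounded symbols: `R_k T_a R_k⁻¹` is the bounded operator of multiplication by `γ`
        (MemLp a ∞ (volume.restrict (Ioi 0)) →
          (toeplitz k fun ζ => a ζ.2).domain = ⊤ ∧
          (mulOp (volume.restrict (Ioi 0)) (gammaFun k a)).domain = ⊤ ∧
          (∀ ξ : ℝ, 0 < ξ →
            IntegrableOn (fun v => a (v / (2 * ξ)) * ((laguerreFun k v ^ 2 : ℝ) : ℂ)) (Ioi 0) ∧
            ‖gammaFun k a ξ‖ ≤ (eLpNorm a ∞ (volume.restrict (Ioi 0))).toReal) ∧
          UnitarilyEquivalentVia R (toeplitz k fun ζ => a ζ.2)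
            (mulOp (volume.restrict (Ioi 0)) (gammaFun k a))) ∧
        -- arbitrary measurable symbols: the image under `R_k` of the natural domain of `T_a`,
        -- and multiplication by `γ` there
        (∀ F : waveletSubspace k, F ∈ (toeplitz k fun ζ => a ζ.2).domain ↔
          ∫⁻ ξ in Ioi (0 : ℝ), (∫⁻ v in Ioi (0 : ℝ),
            ‖a (v / (2 * ξ))‖ₑ ^ 2 * ENNReal.ofReal (laguerreFun k v ^ 2)) * ‖R F ξ‖ₑ ^ 2 < ∞) ∧
        ∀ F : (toeplitz k fun ζ => a ζ.2).domain,
          (∀ᵐ ξ ∂(volume.restrict (Ioi 0)), R F ξ ≠ 0 →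
            IntegrableOn (fun v => a (v / (2 * ξ)) * ((laguerreFun k v ^ 2 : ℝ) : ℂ)) (Ioi 0)) ∧
          ∃ h : R F ∈ (mulOp (volume.restrict (Ioi 0)) (gammaFun k a)).domain,
            R ((toeplitz k fun ζ => a ζ.2) F) =
              mulOp (volume.restrict (Ioi 0)) (gammaFun k a) ⟨R F, h⟩ := by
  have hP := hasOrthogonalProjection_waveletSubspace k
  refine ⟨hP, bargmann k, isBargmann_bargmann k, fun a ha => ?_⟩
  have hdom : ∀ F : waveletSubspace k, F ∈ (toeplitz k fun ζ => a ζ.2).domain ↔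
      ∫⁻ ξ in Ioi (0 : ℝ), (∫⁻ v in Ioi (0 : ℝ),
        ‖a (v / (2 * ξ))‖ₑ ^ 2 * ENNReal.ofReal (laguerreFun k v ^ 2)) *
          ‖bargmann k F ξ‖ₑ ^ 2 < ∞ := fun F =>
    (mem_toeplitz_domain_iff k F).trans (memLp_symbol_mul_bargmannInv_iff k ha
      (Lp.stronglyMeasurable _) (Lp.memLp _))
  refine ⟨fun hb => ?_, hdom, fun F => ⟨?_, ?_⟩⟩
  · have htop : (toeplitz k fun ζ => a ζ.2).domain = ⊤ := by
      rw [eq_top_iff]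
      exact fun F _ => (hdom F).2 (lintegral_symbol_finite_of_bounded k hb _)
    have htop' : (mulOp (volume.restrict (Ioi 0)) (gammaFun k a)).domain = ⊤ := by
      rw [eq_top_iff]
      exact fun f _ => memLp_gammaFun_mul k ha (Lp.stronglyMeasurable f)
        (lintegral_symbol_finite_of_bounded k hb f)
    refine ⟨htop, htop', fun ξ hξ => ⟨integrableOn_bounded_mul_laguerreFun_sq k hb hξ,
      norm_gammaFun_le k hb hξ⟩, fun x y => ?_⟩
    have hx : x ∈ (toeplitz k fun ζ => a ζ.2).domain := htop ▸ Submodule.mem_top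
    have hx' : bargmann k x ∈ (mulOp (volume.restrict (Ioi 0)) (gammaFun k a)).domain :=
      htop' ▸ Submodule.mem_top
    -- Both domains are the whole space, so the two graph conditions differ only by this identity
    -- and the injectivity of R.
    have key := bargmann_toeplitz k ha ⟨x, hx⟩ hx'
    rw [LinearPMap.mem_graph_iff, LinearPMap.mem_graph_iff]
    constructor
    · rintro ⟨x', h1, rfl⟩
      obtain rfl : x' = ⟨x, hx⟩ := Subtype.ext h1
      exact ⟨⟨bargmann k x, hx'⟩, rfl, key.symm⟩
    · rintro ⟨x', h1, h2⟩
      obtain rfl : x' = ⟨bargmann k x, hx'⟩ := Subtype.ext h1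
      exact ⟨⟨x, hx⟩, rfl, (bargmann k).injective (key.trans h2)⟩
  · filter_upwards [ae_finite_of_lintegral_finite k ha (Lp.stronglyMeasurable _)
      ((hdom F).1 F.2), ae_restrict_mem measurableSet_Ioi] with ξ h1 h2 h3
    exact integrableOn_symbol_mul_laguerreFun_sq k ha h2 (h1 h3)
  · have h := memLp_gammaFun_mul k ha (Lp.stronglyMeasurable _) ((hdom F).1 F.2)
    exact ⟨h, bargmann_toeplitz k ha F h⟩
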